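/- Let $k$ be a commutative ring and let $d\ge 0$ be an integer. For a $k$-module $M$ put $\Gamma^d(M):=(M^{\otimes d})^{S_d}$, where the symmetric group $S_d$ permutes the tensor factors. Let $\Gamma^dP_k$ be the category whose objects are the finitely generated projective $k$-modules, with morphisms $\operatorname{Hom}_{\Gamma^dP_k}(V,W):=\Gamma^d(\operatorname{Hom}_k(V,W))$ and with composition induced by factorwise composition of linear maps. The tensor product of modules, together with factorwise tensor product of linear maps, gives a bifunctor $(V,W)\mapsto V\otimes W$ on $\Gamma^dP_k$. Let $\operatorname{Rep}\Gamma^d_k$ be the category of strict polynomial functors of degree $d$, i.e. of $k$-linear functors $\Gamma^dP_k\to k\text{-Mod}$ and natural transformations. For $V$ in $\Gamma^dP_k$ let $\Gamma^{d,V}:=\operatorname{Hom}_{\Gamma^dP_k}(V,-)$ be the representable functor. For $X,Y$ in $\operatorname{Rep}\Gamma^d_k$ the internal tensor product is $$X\,\underline{\otimes}\,Y:=\operatorname*{colim}_{\Gamma^{d,V}\to X}\ \operatorname*{colim}_{\Gamma^{d,W}\to Y}\ \Gamma^{d,V\otimes W},$$ where the colimits run over the categories of morphisms from representable functors to $X$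 and to $Y$. Let $\mathrm{Sym}^d$ and $\wedge^d$ denote the strict polynomial functors $V\mapsto \mathrm{Sym}^d(V)$ and $V\mapsto\wedge^d(V)$, on which an element of $\Gamma^d(\operatorname{Hom}_k(V,W))$ acts through the map $V^{\otimes d}\to W^{\otimes d}$ that it defines. Then there are isomorphisms in $\operatorname{Rep}\Gamma^d_k$ $$\wedge^d\,\underline{\otimes}\,\wedge^d\simeq \mathrm{Sym}^d,\qquad \mathrm{Sym}^d\,\underline{\otimes}\,\mathrm{Sym}^d\simeq \mathrm{Sym}^d.$$ If $2$ is invertible in $k$, then $\mathrm{Sym}^d\,\underline{\otimes}\,\wedge^d\simeq\wedge^d$. If $2=0$ in $k$, then $\mathrm{Sym}^d\,\underline{\otimes}\,\wedge^d\simeq\mathrm{Sym}^d$. -/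

import Mathlib

open CategoryTheory CategoryTheory.Limits Opposite TensorProduct

universe u

noncomputable section

namespace StrictPolynomial

/-! ### Divided powers of modules -/

section Modules

variable (k : Type u) [CommRing k] (d : ℕ)

/-- The action of `σ ∈ S_d` on `V^{⊗ d}` by permuting the tensor factors. -/
def permAct (V : Type u) [AddCommGroup V] [Module k V] (σ : Equiv.Perm (Fin d)) :
    (⨂[k]^d V) ≃ₗ[k] (⨂[k]^d V) :=
  PiTensorProduct.reindex k (fun _ => V) σ

@[simp]
theorem permAct_tprod (V : Type u) [AddCommGroup V] [Module k V] (σ : Equiv.Perm (Fin d))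
    (v : Fin d → V) :
    permAct k d V σ (PiTensorProduct.tprod k v) = PiTensorProduct.tprod k (fun i => v (σ.symm i)) :=
  PiTensorProduct.reindex_tprod σ v

/-- The `d`-th divided power `Γ^d(V) = (V^{⊗ d})^{S_d}`. -/
def dividedPower (V : Type u) [AddCommGroup V] [Module k V] : Submodule k (⨂[k]^d V) where
  carrier := {x | ∀ σ : Equiv.Perm (Fin d), permAct k d V σ x = x}
  add_mem' hx hy σ := by rw [map_add, hx σ, hy σ]
  zero_mem' σ := map_zero _
  smul_mem' c x hx σ := by rw [map_smul, hx σ]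

variable {k d} {U V W U' V' W' : Type u}
  [AddCommGroup U] [Module k U] [AddCommGroup V] [Module k V] [AddCommGroup W] [Module k W]
  [AddCommGroup U'] [Module k U'] [AddCommGroup V'] [Module k V'] [AddCommGroup W'] [Module k W']

/-- Extend a bilinear map `U × V → W` factorwise to `U^{⊗ d} × V^{⊗ d} → W^{⊗ d}`. -/
def factorwise (B : U →ₗ[k] V →ₗ[k] W) : (⨂[k]^d U) →ₗ[k] (⨂[k]^d V) →ₗ[k] (⨂[k]^d W) :=
  PiTensorProduct.map₂ (fun _ => B)

@[simp]
theorem factorwise_tprod (B : U →ₗ[k] V →ₗ[k] W) (x : Fin d → U) (y : Fin d → V) :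
    factorwise B (PiTensorProduct.tprod k x) (PiTensorProduct.tprod k y) =
      PiTensorProduct.tprod k (fun i => B (x i) (y i)) :=
  PiTensorProduct.map₂_tprod_tprod _ x y

theorem tensor_induction {p : (⨂[k]^d V) → Prop} (x : ⨂[k]^d V)
    (h : ∀ v : Fin d → V, p (PiTensorProduct.tprod k v))
    (h_add : ∀ a b, p a → p b → p (a + b)) (h_smul : ∀ (c : k) a, p a → p (c • a)) : p x :=
  PiTensorProduct.induction_on x (fun c v => h_smul c _ (h v)) (fun a b => h_add a b)

theorem permAct_factorwise (B : U →ₗ[k] V →ₗ[k] W) (σ : Equiv.Perm (Fin d))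
    (x : ⨂[k]^d U) (y : ⨂[k]^d V) :
    permAct k d W σ (factorwise B x y) = factorwise B (permAct k d U σ x) (permAct k d V σ y) := by
  induction x using tensor_induction with
  | h_add a b ha hb => simp only [map_add, LinearMap.add_apply, ha, hb]
  | h_smul c a ha => simp only [map_smul, LinearMap.smul_apply, ha]
  | h u =>
    induction y using tensor_induction with
    | h_add a b ha hb => simp only [map_add, ha, hb]
    | h_smul c a ha => simp only [map_smul, ha]
    | h v => simp

/-- A bilinear map `U × V → W` induces `Γ^d(U) × Γ^d(V) → Γ^d(W)`. -/
def dividedPowerMap₂ (B : U →ₗ[k] V →ₗ[k] W) :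
    dividedPower k d U →ₗ[k] dividedPower k d V →ₗ[k] dividedPower k d W :=
  LinearMap.mk₂ k
    (fun x y => ⟨factorwise B x.1 y.1, fun σ => by
      rw [permAct_factorwise, x.2 σ, y.2 σ]⟩)
    (fun x x' y => by ext; simp) (fun c x y => by ext; simp)
    (fun x y y' => by ext; simp) (fun c x y => by ext; simp)

@[simp]
theorem dividedPowerMap₂_coe (B : U →ₗ[k] V →ₗ[k] W) (x : dividedPower k d U)
    (y : dividedPower k d V) : (dividedPowerMap₂ B x y : ⨂[k]^d W) = factorwise B x.1 y.1 := rfl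

/-- The element `u ⊗ ⋯ ⊗ u` of `Γ^d(U)`. -/
def dividedPowerDiag (u : U) : dividedPower k d U :=
  ⟨PiTensorProduct.tprod k (fun _ => u), fun σ => by simp⟩

@[simp]
theorem dividedPowerDiag_coe (u : U) :
    (dividedPowerDiag (k := k) (d := d) u : ⨂[k]^d U) = PiTensorProduct.tprod k (fun _ => u) := rfl

/-- The composition pairing `(g, f) ↦ g ∘ f`. -/
def compBilin : (V →ₗ[k] W) →ₗ[k] (U →ₗ[k] V) →ₗ[k] (U →ₗ[k] W) :=
  LinearMap.mk₂ k (fun g f => g ∘ₗ f) (fun g g' f => LinearMap.add_comp f g' g)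
    (fun c g f => LinearMap.smul_comp c g f) (fun g f f' => LinearMap.comp_add f f' g)
    (fun c g f => LinearMap.comp_smul g c f)

@[simp]
theorem compBilin_apply (g : V →ₗ[k] W) (f : U →ₗ[k] V) : compBilin g f = g ∘ₗ f := rfl

/-- The evaluation pairing `(f, v) ↦ f v`. -/
def evalBilin : (V →ₗ[k] W) →ₗ[k] V →ₗ[k] W := LinearMap.id

@[simp]
theorem evalBilin_apply (f : V →ₗ[k] W) (v : V) : evalBilin f v = f v := rfl

/-- The pairing `(f, g) ↦ f ⊗ g`. -/
def tensorBilin : (U →ₗ[k] U') →ₗ[k] (V →ₗ[k] V') →ₗ[k] (U ⊗[k] V →ₗ[k] U' ⊗[k] V') :=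
  TensorProduct.mapBilinear (RingHom.id k) U V U' V'

@[simp]
theorem tensorBilin_apply (f : U →ₗ[k] U') (g : V →ₗ[k] V') :
    tensorBilin f g = TensorProduct.map f g := rfl

theorem factorwise_id_comp (f : ⨂[k]^d (U →ₗ[k] V)) :
    factorwise compBilin (PiTensorProduct.tprod k (fun _ => (LinearMap.id : V →ₗ[k] V))) f = f := by
  induction f using tensor_induction with
  | h_add a b ha hb => simp only [map_add, ha, hb]
  | h_smul c a ha => simp only [map_smul, ha]
  | h v => simp

theorem factorwise_comp_id (f : ⨂[k]^d (U →ₗ[k] V)) :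
    factorwise compBilin f (PiTensorProduct.tprod k (fun _ => (LinearMap.id : U →ₗ[k] U))) = f := by
  induction f using tensor_induction with
  | h_add a b ha hb => simp only [map_add, LinearMap.add_apply, ha, hb]
  | h_smul c a ha => simp only [map_smul, LinearMap.smul_apply, ha]
  | h v => simp

theorem factorwise_comp_assoc {T : Type u} [AddCommGroup T] [Module k T]
    (h : ⨂[k]^d (V →ₗ[k] W)) (g : ⨂[k]^d (U →ₗ[k] V)) (f : ⨂[k]^d (T →ₗ[k] U)) :
    factorwise compBilin h (factorwise compBilin g f) =
      factorwise compBilin (factorwise compBilin h g) f := by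
  induction h using tensor_induction with
  | h_add a b ha hb => simp only [map_add, LinearMap.add_apply, ha, hb]
  | h_smul c a ha => simp only [map_smul, LinearMap.smul_apply, ha]
  | h h =>
    induction g using tensor_induction with
    | h_add a b ha hb => simp only [map_add, LinearMap.add_apply, ha, hb]
    | h_smul c a ha => simp only [map_smul, LinearMap.smul_apply, ha]
    | h g =>
      induction f using tensor_induction with
      | h_add a b ha hb => simp only [map_add, ha, hb]
      | h_smul c a ha => simp only [map_smul, ha]
      | h f => simp [LinearMap.comp_assoc]

theorem factorwise_id_eval (x : ⨂[k]^d V) :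
    factorwise evalBilin (PiTensorProduct.tprod k (fun _ => (LinearMap.id : V →ₗ[k] V))) x = x := by
  induction x using tensor_induction with
  | h_add a b ha hb => simp only [map_add, ha, hb]
  | h_smul c a ha => simp only [map_smul, ha]
  | h v => simp

theorem factorwise_comp_eval (g : ⨂[k]^d (V →ₗ[k] W)) (f : ⨂[k]^d (U →ₗ[k] V)) (x : ⨂[k]^d U) :
    factorwise evalBilin (factorwise compBilin g f) x =
      factorwise evalBilin g (factorwise evalBilin f x) := by
  induction g using tensor_induction with
  | h_add a b ha hb => simp only [map_add, LinearMap.add_apply, ha, hb]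
  | h_smul c a ha => simp only [map_smul, LinearMap.smul_apply, ha]
  | h g =>
    induction f using tensor_induction with
    | h_add a b ha hb => simp only [map_add, LinearMap.add_apply, ha, hb]
    | h_smul c a ha => simp only [map_smul, LinearMap.smul_apply, ha]
    | h f =>
      induction x using tensor_induction with
      | h_add a b ha hb => simp only [map_add, ha, hb]
      | h_smul c a ha => simp only [map_smul, ha]
      | h x => simp

theorem factorwise_tensor_comp
    (f' : ⨂[k]^d (U' →ₗ[k] W)) (f : ⨂[k]^d (U →ₗ[k] U'))
    (g' : ⨂[k]^d (V' →ₗ[k] W')) (g : ⨂[k]^d (V →ₗ[k] V')) :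
    factorwise tensorBilin (factorwise compBilin f' f) (factorwise compBilin g' g) =
      factorwise compBilin (factorwise tensorBilin f' g') (factorwise tensorBilin f g) := by
  induction f' using tensor_induction with
  | h_add a b ha hb => simp only [map_add, LinearMap.add_apply, ha, hb]
  | h_smul c a ha => simp only [map_smul, LinearMap.smul_apply, ha]
  | h f' =>
    induction f using tensor_induction with
    | h_add a b ha hb => simp only [map_add, LinearMap.add_apply, ha, hb]
    | h_smul c a ha => simp only [map_smul, LinearMap.smul_apply, ha]
    | h f =>
      induction g' using tensor_induction with
      | h_add a b ha hb => simp only [map_add, LinearMap.add_apply, ha, hb]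
      | h_smul c a ha => simp only [map_smul, LinearMap.smul_apply, ha]
      | h g' =>
        induction g using tensor_induction with
        | h_add a b ha hb => simp only [map_add, ha, hb]
        | h_smul c a ha => simp only [map_smul, ha]
        | h g => simp [TensorProduct.map_comp]

end Modules

/-! ### The divided power category -/

/-- The objects of `Γ^d P_k`: finitely generated projective `k`-modules. -/
structure DivPow (k : Type u) [CommRing k] (d : ℕ) : Type (u + 1) where
  carrier : Type u
  [addCommGroup : AddCommGroup carrier]
  [module : Module k carrier]
  [finite : Module.Finite k carrier]
  [projective : Module.Projective k carrier]

attribute [instance] DivPow.addCommGroup DivPow.module DivPow.finite DivPow.projective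

variable (k : Type u) [CommRing k] (d : ℕ)

namespace DivPow

variable {k d}

/-- The morphisms of `Γ^d P_k`: `Hom(V, W) = Γ^d (Hom_k(V, W))`. -/
def Hom (V W : DivPow k d) : Type u := dividedPower k d (V.carrier →ₗ[k] W.carrier)

instance (V W : DivPow k d) : AddCommGroup (Hom V W) :=
  inferInstanceAs (AddCommGroup (dividedPower k d (V.carrier →ₗ[k] W.carrier)))

instance (V W : DivPow k d) : Module k (Hom V W) :=
  inferInstanceAs (Module k (dividedPower k d (V.carrier →ₗ[k] W.carrier)))

/-- The category `Γ^d P_k`; composition is factorwise composition of linear maps. -/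
instance : Category (DivPow k d) where
  Hom V W := Hom V W
  id V := dividedPowerDiag (LinearMap.id : V.carrier →ₗ[k] V.carrier)
  comp f g := dividedPowerMap₂ compBilin g f
  id_comp f := Subtype.ext (factorwise_comp_id f.1)
  comp_id f := Subtype.ext (factorwise_id_comp f.1)
  assoc f g h := Subtype.ext (factorwise_comp_assoc h.1 g.1 f.1)

/-- The underlying invariant tensor of a morphism. -/
def tensor {V W : DivPow k d} (f : V ⟶ W) : ⨂[k]^d (V.carrier →ₗ[k] W.carrier) :=
  Subtype.val (p := fun x => x ∈ dividedPower k d (V.carrier →ₗ[k] W.carrier)) f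

/-- View an element of `Γ^d (Hom_k(V, W))` as a morphism. -/
def ofTensor {V W : DivPow k d} (f : dividedPower k d (V.carrier →ₗ[k] W.carrier)) : V ⟶ W := f

@[simp]
theorem tensor_ofTensor {V W : DivPow k d} (f : dividedPower k d (V.carrier →ₗ[k] W.carrier)) :
    tensor (ofTensor f) = f.1 := rfl

@[ext]
theorem hom_ext {V W : DivPow k d} {f g : V ⟶ W} (h : tensor f = tensor g) : f = g :=
  Subtype.ext h

theorem permAct_tensor {V W : DivPow k d} (f : V ⟶ W) (σ : Equiv.Perm (Fin d)) :
    permAct k d _ σ (tensor f) = tensor f :=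
  Subtype.property (p := fun x => x ∈ dividedPower k d (V.carrier →ₗ[k] W.carrier)) f σ

@[simp]
theorem tensor_id (V : DivPow k d) :
    tensor (𝟙 V) = PiTensorProduct.tprod k (fun _ => LinearMap.id) := rfl

@[simp]
theorem tensor_comp {U V W : DivPow k d} (f : U ⟶ V) (g : V ⟶ W) :
    tensor (f ≫ g) = factorwise compBilin (tensor g) (tensor f) := rfl

instance : Preadditive (DivPow k d) where
  homGroup V W := inferInstanceAs (AddCommGroup (Hom V W))
  add_comp _ _ _ f f' g := Subtype.ext (map_add (factorwise compBilin (tensor g)) (tensor f) (tensor f'))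
  comp_add _ _ _ f g g' :=
    Subtype.ext (LinearMap.map_add₂ (factorwise compBilin) (tensor g) (tensor g') (tensor f))

instance : Linear k (DivPow k d) where
  homModule V W := inferInstanceAs (Module k (Hom V W))
  smul_comp _ _ _ r f g := Subtype.ext (map_smul (factorwise compBilin (tensor g)) r (tensor f))
  comp_smul _ _ _ f r g :=
    Subtype.ext (LinearMap.map_smul₂ (factorwise compBilin) r (tensor g) (tensor f))

@[simp]
theorem tensor_add {V W : DivPow k d} (f g : V ⟶ W) : tensor (f + g) = tensor f + tensor g := rfl

@[simp]
theorem tensor_smul {V W : DivPow k d} (r : k) (f : V ⟶ W) : tensor (r • f) = r • tensor f := rfl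

/-- The tensor product of `Γ^d P_k` as a bifunctor: `V ⊗_k W` on objects, and the map
`Γ^d Hom(V, V') × Γ^d Hom(W, W') → Γ^d Hom(V ⊗ W, V' ⊗ W')` induced by `(f, g) ↦ f ⊗ g`. -/
def tensorFunctor : DivPow k d ⥤ DivPow k d ⥤ DivPow k d where
  obj V :=
    { obj := fun W => ⟨V.carrier ⊗[k] W.carrier⟩
      map := fun {W W'} g => ofTensor (V := ⟨V.carrier ⊗[k] W.carrier⟩)
        (W := ⟨V.carrier ⊗[k] W'.carrier⟩) (dividedPowerMap₂ tensorBilin (𝟙 V : Hom V V) g)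
      map_id := fun W => by
        ext
        change factorwise tensorBilin (tensor (𝟙 V)) (tensor (𝟙 W)) = _
        simp
      map_comp := fun {W W' W''} g g' => by
        ext
        change factorwise tensorBilin (tensor (𝟙 V)) (tensor (g ≫ g')) =
          factorwise compBilin (factorwise tensorBilin (tensor (𝟙 V)) (tensor g'))
            (factorwise tensorBilin (tensor (𝟙 V)) (tensor g))
        rw [← factorwise_tensor_comp, ← tensor_comp, ← tensor_comp, Category.comp_id] }
  map {V V'} f :=
    { app := fun W => ofTensor (V := ⟨V.carrier ⊗[k] W.carrier⟩)
        (W := ⟨V'.carrier ⊗[k] W.carrier⟩) (dividedPowerMap₂ tensorBilin (f : Hom V V') (𝟙 W : Hom W W))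
      naturality := fun {W W'} g => by
        ext
        change factorwise compBilin (factorwise tensorBilin (tensor f) (tensor (𝟙 W')))
            (factorwise tensorBilin (tensor (𝟙 V)) (tensor g)) =
          factorwise compBilin (factorwise tensorBilin (tensor (𝟙 V')) (tensor g))
            (factorwise tensorBilin (tensor f) (tensor (𝟙 W)))
        rw [← factorwise_tensor_comp, ← factorwise_tensor_comp, ← tensor_comp, ← tensor_comp,
          ← tensor_comp, ← tensor_comp]
        simp only [Category.comp_id, Category.id_comp] }
  map_id V := by
    ext W
    change factorwise tensorBilin (tensor (𝟙 V)) (tensor (𝟙 W)) = _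
    simp
  map_comp {V V' V''} f f' := by
    ext W
    change factorwise tensorBilin (tensor (f ≫ f')) (tensor (𝟙 W)) =
      factorwise compBilin (factorwise tensorBilin (tensor f') (tensor (𝟙 W)))
        (factorwise tensorBilin (tensor f) (tensor (𝟙 W)))
    rw [← factorwise_tensor_comp, ← tensor_comp, ← tensor_comp, Category.comp_id]

/-- Isomorphic modules are isomorphic in `Γ^d P_k`. -/
def isoOfEquiv {V W : DivPow k d} (e : V.carrier ≃ₗ[k] W.carrier) : V ≅ W where
  hom := ofTensor (dividedPowerDiag e.toLinearMap)
  inv := ofTensor (dividedPowerDiag e.symm.toLinearMap)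
  hom_inv_id := by ext; simp
  inv_hom_id := by ext; simp

/-- The category `Γ^d P_k` is essentially small. -/
instance essentiallySmall : EssentiallySmall.{u} (DivPow k d) := by
  rw [essentiallySmall_iff_objectPropertyEssentiallySmall_top]
  let I : Type u := Σ n : ℕ, {S : Submodule k (Fin n → k) // Module.Projective k ((Fin n → k) ⧸ S)}
  let g : I → DivPow k d := fun i =>
    haveI := i.2.2
    ⟨(Fin i.1 → k) ⧸ i.2.1⟩
  refine ⟨.ofObj g, inferInstance, fun V _ => ?_⟩
  obtain ⟨n, S, ⟨e⟩⟩ := Module.Finite.exists_fin_quot_equiv k V.carrier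
  have hS : Module.Projective k ((Fin n → k) ⧸ S) := Module.Projective.of_equiv e.symm
  exact ⟨_, ⟨(⟨n, S, hS⟩ : I)⟩, ⟨isoOfEquiv e.symm⟩⟩

end DivPow

/-! ### Strict polynomial functors -/

/-- A functor `Γ^d P_k ⥤ k`-Mod is `k`-linear if it is additive and `k`-linear on morphisms. -/
def isLinear : ObjectProperty (DivPow k d ⥤ ModuleCat.{u} k) :=
  fun F => F.Additive ∧ F.Linear k

/-- The category `Rep Γ^d_k` of strict polynomial functors of degree `d`: the `k`-linear functors
`Γ^d P_k ⥤ k`-Mod with all natural transformations. -/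
abbrev RepGamma : Type (u + 1) := (isLinear k d).FullSubcategory

instance isLinear_closedUnderColimits (J : Type*) [Category J]
    [HasColimitsOfShape J (ModuleCat.{u} k)] :
    (isLinear k d).IsClosedUnderColimitsOfShape J where
  colimitsOfShape_le := by
    rintro X ⟨p⟩
    have hc : ∀ V : DivPow k d, IsColimit (((evaluation _ _).obj V).mapCocone p.cocone) :=
      fun V => isColimitOfPreserves _ p.isColimit
    refine ⟨⟨fun {V W f g} => (hc V).hom_ext fun j => ?_⟩,
      ⟨fun {V W} f r => (hc V).hom_ext fun j => ?_⟩⟩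
    · have h := (p.prop_diag_obj j).1
      have e : ∀ q : V ⟶ W, (p.ι.app j).app V ≫ X.map q = (p.diag.obj j).map q ≫ (p.ι.app j).app W :=
        fun q => ((p.ι.app j).naturality q).symm
      change (p.ι.app j).app V ≫ X.map (f + g) = (p.ι.app j).app V ≫ (X.map f + X.map g)
      rw [Preadditive.comp_add, e, e, e, h.map_add, Preadditive.add_comp]
    · have h := (p.prop_diag_obj j).2
      have e : ∀ q : V ⟶ W, (p.ι.app j).app V ≫ X.map q = (p.diag.obj j).map q ≫ (p.ι.app j).app W :=
        fun q => ((p.ι.app j).naturality q).symm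
      change (p.ι.app j).app V ≫ X.map (r • f) = (p.ι.app j).app V ≫ (r • X.map f)
      rw [Linear.comp_smul, e, e, h.map_smul, Linear.smul_comp]

/-- The functor `V ↦ Γ^{d,V} = Hom(V, -)`, contravariant in `V`. -/
def representable : (DivPow k d)ᵒᵖ ⥤ RepGamma k d :=
  (isLinear k d).lift (linearCoyoneda k (DivPow k d)) fun V =>
    ⟨inferInstance, ⟨fun f r => by
      ext g
      exact Linear.comp_smul _ _ _ g r f⟩⟩

variable {k d}

/-- The category of morphisms `Γ^{d,V} → X`, with `V` ranging over `Γ^d P_k`. -/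
abbrev RepresentablesOver (X : RepGamma k d) : Type (u + 1) :=
  CostructuredArrow (representable k d) X

instance : LocallySmall.{u} (RepGamma k d) :=
  locallySmall_of_faithful
    ((isLinear k d).ι ⋙ (Functor.whiskeringLeft _ _ _).obj (equivSmallModel.{u} (DivPow k d)).inverse)

instance (X : RepGamma k d) : HasColimitsOfShape (RepresentablesOver X) (ModuleCat.{u} k) :=
  HasColimitsOfShape.of_essentiallySmall.{u, u} _ _

instance (X : RepGamma k d) : HasColimitsOfShape (RepresentablesOver X) (RepGamma k d) :=
  inferInstance

/-- The diagram `(Γ^{d,V} → X) ↦ ((Γ^{d,W} → Y) ↦ Γ^{d, V ⊗ W})`. -/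
def internalTensorDiagram (X Y : RepGamma k d) :
    RepresentablesOver X ⥤ RepresentablesOver Y ⥤ RepGamma k d :=
  CostructuredArrow.proj (representable k d) X ⋙ DivPow.tensorFunctor.op ⋙ Functor.opHom _ _ ⋙
    (Functor.whiskeringLeft _ _ _).obj (CostructuredArrow.proj (representable k d) Y) ⋙
      (Functor.whiskeringRight _ _ _).obj (representable k d)

theorem internalTensorDiagram_obj_obj (X Y : RepGamma k d) (p : RepresentablesOver X)
    (q : RepresentablesOver Y) :
    ((internalTensorDiagram X Y).obj p).obj q =
      (representable k d).obj (op ⟨p.left.unop.carrier ⊗[k] q.left.unop.carrier⟩) := rfl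

/-- The internal tensor product
`X ⊗ Y = colim_{Γ^{d,V} → X} colim_{Γ^{d,W} → Y} Γ^{d, V ⊗ W}`. -/
def internalTensor (X Y : RepGamma k d) : RepGamma k d :=
  colimit (internalTensorDiagram X Y ⋙ colim)

/-! ### Symmetric and exterior powers -/

section Powers

variable {V W : Type u} [AddCommGroup V] [Module k V] [AddCommGroup W] [Module k W]

variable (k d V) in
/-- The submodule of `V^{⊗ d}` spanned by all `σ x - x`. -/
def symRelations : Submodule k (⨂[k]^d V) :=
  Submodule.span k {y | ∃ (σ : Equiv.Perm (Fin d)) (x : ⨂[k]^d V), y = permAct k d V σ x - x}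

variable (k d V) in
/-- The symmetric power `Sym^d(V)`, as the coinvariants `(V^{⊗ d})_{S_d}`. -/
abbrev SymPower : Type u := (⨂[k]^d V) ⧸ symRelations k d V

/-- The map `V^{⊗ d} → W^{⊗ d}` induced by an element of `Hom_k(V, W)^{⊗ d}`. -/
def tensorPowerMap : (⨂[k]^d (V →ₗ[k] W)) →ₗ[k] (⨂[k]^d V) →ₗ[k] (⨂[k]^d W) :=
  factorwise evalBilin

theorem permAct_tensorPowerMap {f : ⨂[k]^d (V →ₗ[k] W)}
    (hf : f ∈ dividedPower k d (V →ₗ[k] W)) (σ : Equiv.Perm (Fin d)) (x : ⨂[k]^d V) :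
    permAct k d W σ (tensorPowerMap f x) = tensorPowerMap f (permAct k d V σ x) := by
  rw [tensorPowerMap, permAct_factorwise, hf σ]

/-- The map `Sym^d(V) → Sym^d(W)` induced by an element of `Γ^d(Hom_k(V, W))`. -/
def symMap (f : ⨂[k]^d (V →ₗ[k] W)) (hf : f ∈ dividedPower k d (V →ₗ[k] W)) :
    SymPower k d V →ₗ[k] SymPower k d W :=
  Submodule.mapQ _ _ (tensorPowerMap f) (by
    rw [symRelations, Submodule.span_le]
    rintro _ ⟨σ, x, rfl⟩
    refine Submodule.subset_span ⟨σ, tensorPowerMap f x, ?_⟩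
    rw [map_sub, permAct_tensorPowerMap hf])

@[simp]
theorem symMap_mk (f : ⨂[k]^d (V →ₗ[k] W)) (hf : f ∈ dividedPower k d (V →ₗ[k] W))
    (x : ⨂[k]^d V) : symMap f hf (Submodule.Quotient.mk x) =
      Submodule.Quotient.mk (tensorPowerMap f x) := rfl

variable (k d V) in
/-- The projection `V^{⊗ d} → ∧^d(V)`, `v₁ ⊗ ⋯ ⊗ v_d ↦ v₁ ∧ ⋯ ∧ v_d`. -/
def wedgeProj : (⨂[k]^d V) →ₗ[k] ⋀[k]^d V :=
  PiTensorProduct.lift (exteriorPower.ιMulti k d (M := V)).toMultilinearMap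

@[simp]
theorem wedgeProj_tprod (v : Fin d → V) :
    wedgeProj k d V (PiTensorProduct.tprod k v) = exteriorPower.ιMulti k d v := by
  simp [wedgeProj]

theorem wedgeProj_surjective : Function.Surjective (wedgeProj k d V) := by
  rw [← LinearMap.range_eq_top, ← top_le_iff, ← exteriorPower.ιMulti_span, Submodule.span_le]
  rintro _ ⟨v, rfl⟩
  exact ⟨PiTensorProduct.tprod k v, wedgeProj_tprod v⟩

theorem toTensorPower_wedgeProj (x : ⨂[k]^d V) :
    exteriorPower.toTensorPower k V d (wedgeProj k d V x) =
      ∑ σ : Equiv.Perm (Fin d), ((Equiv.Perm.sign σ : ℤ) : k) • permAct k d V σ x := by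
  induction x using tensor_induction with
  | h_add a b ha hb => simp only [map_add, ha, hb, smul_add, Finset.sum_add_distrib]
  | h_smul c a ha =>
    simp only [map_smul, ha, Finset.smul_sum]
    exact Finset.sum_congr rfl fun σ _ => smul_comm _ _ _
  | h v =>
    rw [wedgeProj_tprod, exteriorPower.toTensorPower_apply_ιMulti]
    refine Fintype.sum_equiv (Equiv.inv _) _ _ fun σ => ?_
    rw [Equiv.inv_apply, Equiv.Perm.sign_inv, permAct_tprod, Int.cast_smul_eq_zsmul]
    rfl

theorem toTensorPower_map (f : V →ₗ[k] W) (x : ⋀[k]^d V) :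
    exteriorPower.toTensorPower k W d (exteriorPower.map d f x) =
      PiTensorProduct.map (fun _ => f) (exteriorPower.toTensorPower k V d x) := by
  have : exteriorPower.toTensorPower k W d ∘ₗ exteriorPower.map d f =
      PiTensorProduct.map (fun _ => f) ∘ₗ exteriorPower.toTensorPower k V d := by
    apply exteriorPower.linearMap_ext
    ext v
    simp [Units.smul_def]
  exact LinearMap.congr_fun this x

theorem toTensorPower_injective_of_free {I : Type*} [LinearOrder I] (b : Module.Basis I k V) :
    Function.Injective (exteriorPower.toTensorPower k V d) := by
  rw [injective_iff_map_eq_zero]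
  intro x hx
  have h : ∀ f : Fin d → Module.Dual k V,
      exteriorPower.pairingDual k V d (exteriorPower.ιMulti k d f) x = 0 := by
    intro f
    rw [exteriorPower.pairingDual, exteriorPower.alternatingMapLinearEquiv_apply_ιMulti]
    change TensorPower.multilinearMapToDual k V d f (exteriorPower.toTensorPower k V d x) = 0
    rw [hx, map_zero]
  apply (b.exteriorPower d).repr.injective
  ext s
  rw [exteriorPower.basis_repr_apply, map_zero]
  exact h _

/-- For projective `V`, antisymmetrization embeds `∧^d(V)` in `V^{⊗ d}`. -/
theorem toTensorPower_injective [Module.Finite k V] [Module.Projective k V] :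
    Function.Injective (exteriorPower.toTensorPower k V d) := by
  obtain ⟨n, p, s, -, -, hps⟩ := Module.Finite.exists_comp_eq_id_of_projective k V
  rw [injective_iff_map_eq_zero]
  intro x hx
  apply exteriorPower.map_injective p hps
  apply toTensorPower_injective_of_free (Pi.basisFun k (Fin n))
  rw [toTensorPower_map, hx, map_zero, map_zero, map_zero]

theorem toTensorPower_comp {f : ⨂[k]^d (V →ₗ[k] W)} (hf : f ∈ dividedPower k d (V →ₗ[k] W))
    (x : ⨂[k]^d V) :
    exteriorPower.toTensorPower k W d (wedgeProj k d W (tensorPowerMap f x)) =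
      tensorPowerMap f (exteriorPower.toTensorPower k V d (wedgeProj k d V x)) := by
  simp only [toTensorPower_wedgeProj, permAct_tensorPowerMap hf, map_sum, map_smul]

theorem wedgeMap_ext {g g' : (⋀[k]^d V) →ₗ[k] ⋀[k]^d W}
    (h : ∀ x, g (wedgeProj k d V x) = g' (wedgeProj k d V x)) : g = g' := by
  refine LinearMap.ext fun y => ?_
  obtain ⟨x, rfl⟩ := wedgeProj_surjective y
  exact h x

variable [Module.Finite k W] [Module.Projective k W]

/-- The map `∧^d(V) → ∧^d(W)` induced by an element of `Γ^d(Hom_k(V, W))`: the unique map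
compatible with the projections `V^{⊗ d} → ∧^d(V)` and `W^{⊗ d} → ∧^d(W)`. -/
def wedgeMap (f : ⨂[k]^d (V →ₗ[k] W)) (hf : f ∈ dividedPower k d (V →ₗ[k] W)) :
    (⋀[k]^d V) →ₗ[k] ⋀[k]^d W :=
  exteriorPower.alternatingMapLinearEquiv
    { (wedgeProj k d W ∘ₗ tensorPowerMap f).compMultilinearMap (PiTensorProduct.tprod k) with
      map_eq_zero_of_eq' := fun v i j hv hij => by
        apply toTensorPower_injective
        change exteriorPower.toTensorPower k W d
          (wedgeProj k d W (tensorPowerMap f (PiTensorProduct.tprod k v))) = _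
        rw [toTensorPower_comp hf, wedgeProj_tprod, AlternatingMap.map_eq_zero_of_eq _ v hv hij]
        simp only [map_zero] }

@[simp]
theorem wedgeMap_wedgeProj (f : ⨂[k]^d (V →ₗ[k] W)) (hf : f ∈ dividedPower k d (V →ₗ[k] W))
    (x : ⨂[k]^d V) :
    wedgeMap f hf (wedgeProj k d V x) = wedgeProj k d W (tensorPowerMap f x) := by
  induction x using tensor_induction with
  | h_add a b ha hb => simp only [map_add, ha, hb]
  | h_smul c a ha => simp only [map_smul, ha]
  | h v =>
    rw [wedgeProj_tprod, wedgeMap, exteriorPower.alternatingMapLinearEquiv_apply_ιMulti]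
    rfl

end Powers

namespace DivPow

theorem tensor_mem {V W : DivPow k d} (f : V ⟶ W) :
    tensor f ∈ dividedPower k d (V.carrier →ₗ[k] W.carrier) :=
  fun σ => permAct_tensor f σ

theorem tensorPowerMap_id (V : DivPow k d) (x : ⨂[k]^d V.carrier) :
    tensorPowerMap (tensor (𝟙 V)) x = x :=
  factorwise_id_eval x

theorem tensorPowerMap_comp {U V W : DivPow k d} (f : U ⟶ V) (g : V ⟶ W) (x : ⨂[k]^d U.carrier) :
    tensorPowerMap (tensor (f ≫ g)) x = tensorPowerMap (tensor g) (tensorPowerMap (tensor f) x) :=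
  factorwise_comp_eval (tensor g) (tensor f) x

/-- The action of a morphism of `Γ^d P_k` on symmetric powers. -/
def symAction {V W : DivPow k d} (f : V ⟶ W) :
    SymPower k d V.carrier →ₗ[k] SymPower k d W.carrier :=
  symMap (tensor f) (tensor_mem f)

@[simp]
theorem symAction_mk {V W : DivPow k d} (f : V ⟶ W) (x : ⨂[k]^d V.carrier) :
    symAction f (Submodule.Quotient.mk x) =
      Submodule.Quotient.mk (tensorPowerMap (tensor f) x) := rfl

theorem symAction_ext {V W : DivPow k d} {g g' : SymPower k d V.carrier →ₗ[k] SymPower k d W.carrier}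
    (h : ∀ x, g (Submodule.Quotient.mk x) = g' (Submodule.Quotient.mk x)) : g = g' := by
  refine LinearMap.ext fun y => ?_
  obtain ⟨x, rfl⟩ := Submodule.Quotient.mk_surjective _ y
  exact h x

theorem symAction_id (V : DivPow k d) : symAction (𝟙 V) = LinearMap.id :=
  symAction_ext fun x => by rw [symAction_mk, tensorPowerMap_id, LinearMap.id_apply]

theorem symAction_comp {U V W : DivPow k d} (f : U ⟶ V) (g : V ⟶ W) :
    symAction (f ≫ g) = symAction g ∘ₗ symAction f :=
  symAction_ext fun x => by
    rw [LinearMap.comp_apply, symAction_mk, symAction_mk, symAction_mk, tensorPowerMap_comp]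

theorem symAction_add {V W : DivPow k d} (f g : V ⟶ W) :
    symAction (f + g) = symAction f + symAction g :=
  symAction_ext fun x => by
    rw [LinearMap.add_apply, symAction_mk, symAction_mk, symAction_mk, tensor_add, map_add,
      LinearMap.add_apply, Submodule.Quotient.mk_add]

theorem symAction_smul {V W : DivPow k d} (r : k) (f : V ⟶ W) :
    symAction (r • f) = r • symAction f :=
  symAction_ext fun x => by
    rw [LinearMap.smul_apply, symAction_mk, symAction_mk, tensor_smul, map_smul,
      LinearMap.smul_apply, Submodule.Quotient.mk_smul]

/-- The action of a morphism of `Γ^d P_k` on exterior powers. -/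
def wedgeAction {V W : DivPow k d} (f : V ⟶ W) : (⋀[k]^d V.carrier) →ₗ[k] ⋀[k]^d W.carrier :=
  wedgeMap (tensor f) (tensor_mem f)

@[simp]
theorem wedgeAction_wedgeProj {V W : DivPow k d} (f : V ⟶ W) (x : ⨂[k]^d V.carrier) :
    wedgeAction f (wedgeProj k d V.carrier x) =
      wedgeProj k d W.carrier (tensorPowerMap (tensor f) x) :=
  wedgeMap_wedgeProj _ _ x

theorem wedgeAction_id (V : DivPow k d) : wedgeAction (𝟙 V) = LinearMap.id :=
  wedgeMap_ext fun x => by rw [wedgeAction_wedgeProj, tensorPowerMap_id, LinearMap.id_apply]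

theorem wedgeAction_comp {U V W : DivPow k d} (f : U ⟶ V) (g : V ⟶ W) :
    wedgeAction (f ≫ g) = wedgeAction g ∘ₗ wedgeAction f :=
  wedgeMap_ext fun x => by
    rw [LinearMap.comp_apply, wedgeAction_wedgeProj, wedgeAction_wedgeProj, wedgeAction_wedgeProj,
      tensorPowerMap_comp]

theorem wedgeAction_add {V W : DivPow k d} (f g : V ⟶ W) :
    wedgeAction (f + g) = wedgeAction f + wedgeAction g :=
  wedgeMap_ext fun x => by
    rw [LinearMap.add_apply, wedgeAction_wedgeProj, wedgeAction_wedgeProj, wedgeAction_wedgeProj,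
      tensor_add, map_add, LinearMap.add_apply, map_add]

theorem wedgeAction_smul {V W : DivPow k d} (r : k) (f : V ⟶ W) :
    wedgeAction (r • f) = r • wedgeAction f :=
  wedgeMap_ext fun x => by
    rw [LinearMap.smul_apply, wedgeAction_wedgeProj, wedgeAction_wedgeProj,
      tensor_smul, map_smul, LinearMap.smul_apply, map_smul]

end DivPow

variable (k d)

/-- The strict polynomial functor `Sym^d`. -/
def sym : RepGamma k d where
  obj :=
    { obj := fun V => ModuleCat.of k (SymPower k d V.carrier)
      map := fun f => ModuleCat.ofHom (DivPow.symAction f)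
      map_id := fun V => ModuleCat.hom_ext (DivPow.symAction_id V)
      map_comp := fun f g => ModuleCat.hom_ext (DivPow.symAction_comp f g) }
  property :=
    ⟨⟨fun {_ _ f g} => ModuleCat.hom_ext (DivPow.symAction_add f g)⟩,
      ⟨fun f r => ModuleCat.hom_ext (DivPow.symAction_smul r f)⟩⟩

/-- The strict polynomial functor `∧^d`. -/
def wedge : RepGamma k d where
  obj :=
    { obj := fun V => ModuleCat.of k (⋀[k]^d V.carrier)
      map := fun f => ModuleCat.ofHom (DivPow.wedgeAction f)
      map_id := fun V => ModuleCat.hom_ext (DivPow.wedgeAction_id V)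
      map_comp := fun f g => ModuleCat.hom_ext (DivPow.wedgeAction_comp f g) }
  property :=
    ⟨⟨fun {_ _ f g} => ModuleCat.hom_ext (DivPow.wedgeAction_add f g)⟩,
      ⟨fun f r => ModuleCat.hom_ext (DivPow.wedgeAction_smul r f)⟩⟩

end StrictPolynomial

end

/-!
By the co-Yoneda description of the iterated colimit, `X ⊗ Y` corepresents the natural pairings
`X(V) × Y(W) → Z(V ⊗ W)`. The functors `Sym^d` and `∧^d` are quotients of `V ↦ V^{⊗ d}` on which
`S_d` acts through a character, and each is generated by the class of `e_1 ⊗ ⋯ ⊗ e_d` over `k^d`.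

Let `S_d` act on `X` and `Y` through `χ` and `ψ`. A pairing is determined by the image `ζ ∈ Z(k^d)`
of the two generators under the multiplication `k^d ⊗ k^d → k^d`, and `S_d` acts on `ζ` through
`χψ`. Conversely, if `S` is the functor of `χψ`-twisted coinvariants of `V^{⊗ d}`, then
`(x, y) ↦ x ⊗ N y`, with `N` the `ψ`-twisted norm, is a pairing with values in `S` for which `ζ`
is the generator. It is therefore universal, and `X ⊗ Y ≅ S`. The theorem now comes down to
`sgn · sgn = 1`, to `1 · θ = θ`, to `∧^d` being the `sgn`-twisted coinvariants when `2` is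
invertible, and to `sgn = 1` when `2 = 0`.
-/

noncomputable section

namespace StrictPolynomial

section TensorPowers

variable {k : Type u} [CommRing k] {d : ℕ} {U V W U' V' W' T T' R R' : Type u}
  [AddCommGroup U] [Module k U] [AddCommGroup V] [Module k V] [AddCommGroup W] [Module k W]
  [AddCommGroup U'] [Module k U'] [AddCommGroup V'] [Module k V'] [AddCommGroup W'] [Module k W']
  [AddCommGroup T] [Module k T] [AddCommGroup T'] [Module k T']
  [AddCommGroup R] [Module k R] [AddCommGroup R'] [Module k R']

theorem factorwise_assoc {B : U →ₗ[k] V →ₗ[k] T} {C : T →ₗ[k] W →ₗ[k] W'}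
    {B' : V →ₗ[k] W →ₗ[k] T'} {C' : U →ₗ[k] T' →ₗ[k] W'}
    (h : ∀ u v w, C (B u v) w = C' u (B' v w))
    (x : ⨂[k]^d U) (y : ⨂[k]^d V) (z : ⨂[k]^d W) :
    factorwise C (factorwise B x y) z = factorwise C' x (factorwise B' y z) := by
  induction x using tensor_induction with
  | h_add a b ha hb => simp only [map_add, LinearMap.add_apply, ha, hb]
  | h_smul c a ha => simp only [map_smul, LinearMap.smul_apply, ha]
  | h x =>
    induction y using tensor_induction with
    | h_add a b ha hb => simp only [map_add, LinearMap.add_apply, ha, hb]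
    | h_smul c a ha => simp only [map_smul, LinearMap.smul_apply, ha]
    | h y =>
      induction z using tensor_induction with
      | h_add a b ha hb => simp only [map_add, ha, hb]
      | h_smul c a ha => simp only [map_smul, ha]
      | h z => simp only [factorwise_tprod, h]

theorem factorwise_interchange {B : U →ₗ[k] V →ₗ[k] T} {B' : U' →ₗ[k] V' →ₗ[k] T'}
    {P : T →ₗ[k] T' →ₗ[k] W} {C : U →ₗ[k] U' →ₗ[k] R} {C' : V →ₗ[k] V' →ₗ[k] R'}
    {Q : R →ₗ[k] R' →ₗ[k] W}
    (h : ∀ u v u' v', P (B u v) (B' u' v') = Q (C u u') (C' v v'))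
    (x : ⨂[k]^d U) (y : ⨂[k]^d V) (x' : ⨂[k]^d U') (y' : ⨂[k]^d V') :
    factorwise P (factorwise B x y) (factorwise B' x' y') =
      factorwise Q (factorwise C x x') (factorwise C' y y') := by
  induction x using tensor_induction with
  | h_add a b ha hb => simp only [map_add, LinearMap.add_apply, ha, hb]
  | h_smul c a ha => simp only [map_smul, LinearMap.smul_apply, ha]
  | h x =>
    induction y using tensor_induction with
    | h_add a b ha hb => simp only [map_add, LinearMap.add_apply, ha, hb]
    | h_smul c a ha => simp only [map_smul, LinearMap.smul_apply, ha]
    | h y =>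
      induction x' using tensor_induction with
      | h_add a b ha hb => simp only [map_add, LinearMap.add_apply, ha, hb]
      | h_smul c a ha => simp only [map_smul, LinearMap.smul_apply, ha]
      | h x' =>
        induction y' using tensor_induction with
        | h_add a b ha hb => simp only [map_add, ha, hb]
        | h_smul c a ha => simp only [map_smul, ha]
        | h y' => simp only [factorwise_tprod, h]

theorem permAct_permAct (σ τ : Equiv.Perm (Fin d)) (x : ⨂[k]^d V) :
    permAct k d V σ (permAct k d V τ x) = permAct k d V (σ * τ) x :=
  PiTensorProduct.reindex_reindex τ σ x

theorem permAct_one (x : ⨂[k]^d V) : permAct k d V 1 x = x := by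
  induction x using tensor_induction with
  | h_add a b ha hb => rw [map_add, ha, hb]
  | h_smul c a ha => rw [map_smul, ha]
  | h v => exact permAct_tprod k d V 1 v

variable (k d V W) in
/-- The map `V^{⊗ d} × W^{⊗ d} → (V ⊗ W)^{⊗ d}` interleaving the tensor factors. -/
def interleave : (⨂[k]^d V) →ₗ[k] (⨂[k]^d W) →ₗ[k] (⨂[k]^d (V ⊗[k] W)) :=
  factorwise (TensorProduct.mk k V W)

theorem permAct_interleave (σ : Equiv.Perm (Fin d)) (x : ⨂[k]^d V) (y : ⨂[k]^d W) :
    permAct k d _ σ (interleave k d V W x y) =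
      interleave k d V W (permAct k d V σ x) (permAct k d W σ y) :=
  permAct_factorwise _ σ x y

theorem tensorPowerMap_interleave (f : ⨂[k]^d (V →ₗ[k] V')) (g : ⨂[k]^d (W →ₗ[k] W'))
    (x : ⨂[k]^d V) (y : ⨂[k]^d W) :
    tensorPowerMap (factorwise tensorBilin f g) (interleave k d V W x y) =
      interleave k d V' W' (tensorPowerMap f x) (tensorPowerMap g y) :=
  factorwise_interchange (fun _ _ _ _ => rfl) f g x y

/-! ### Twisted norms -/

/-- The norm `∑_ρ χ(ρ⁻¹) ρ` of the action of `S_d` on `V^{⊗ d}` twisted by a character `χ`. -/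
def twistedNorm (χ : Equiv.Perm (Fin d) →* k) : (⨂[k]^d V) →ₗ[k] (⨂[k]^d V) :=
  ∑ ρ : Equiv.Perm (Fin d), χ ρ⁻¹ • (permAct k d V ρ).toLinearMap

theorem twistedNorm_apply (χ : Equiv.Perm (Fin d) →* k) (x : ⨂[k]^d V) :
    twistedNorm χ x = ∑ ρ : Equiv.Perm (Fin d), χ ρ⁻¹ • permAct k d V ρ x := by
  simp only [twistedNorm, LinearMap.sum_apply, LinearMap.smul_apply, LinearEquiv.coe_coe]

theorem permAct_twistedNorm (χ : Equiv.Perm (Fin d) →* k) (τ : Equiv.Perm (Fin d))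
    (x : ⨂[k]^d V) : permAct k d V τ (twistedNorm χ x) = χ τ • twistedNorm χ x := by
  simp only [twistedNorm_apply, map_sum, map_smul, permAct_permAct, Finset.smul_sum, smul_smul]
  refine Fintype.sum_equiv (Equiv.mulLeft τ) _ _ fun ρ => ?_
  rw [Equiv.coe_mulLeft, mul_inv_rev, map_mul, mul_left_comm, ← map_mul χ τ, mul_inv_cancel,
    map_one, mul_one]

theorem twistedNorm_permAct (χ : Equiv.Perm (Fin d) →* k) (τ : Equiv.Perm (Fin d))
    (x : ⨂[k]^d V) : twistedNorm χ (permAct k d V τ x) = χ τ • twistedNorm χ x := by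
  simp only [twistedNorm_apply, permAct_permAct, Finset.smul_sum, smul_smul, ← map_mul]
  refine Fintype.sum_equiv (Equiv.mulRight τ) _ _ fun ρ => ?_
  rw [Equiv.coe_mulRight, mul_inv_rev, mul_inv_cancel_left]

theorem tensorPowerMap_twistedNorm (χ : Equiv.Perm (Fin d) →* k) {f : ⨂[k]^d (V →ₗ[k] W)}
    (hf : f ∈ dividedPower k d (V →ₗ[k] W)) (x : ⨂[k]^d V) :
    tensorPowerMap f (twistedNorm χ x) = twistedNorm χ (tensorPowerMap f x) := by
  simp only [twistedNorm_apply, map_sum, map_smul, permAct_tensorPowerMap hf]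

/-- The symmetrization `x ↦ ∑_ρ ρ x`, with values in the divided power. -/
def symmetrize : (⨂[k]^d V) →ₗ[k] dividedPower k d V :=
  (twistedNorm 1).codRestrict _ fun x τ => by
    rw [permAct_twistedNorm, MonoidHom.one_apply, one_smul]

theorem symmetrize_coe (x : ⨂[k]^d V) :
    (symmetrize x : ⨂[k]^d V) = ∑ ρ : Equiv.Perm (Fin d), permAct k d V ρ x := by
  change twistedNorm 1 x = _
  simp only [twistedNorm_apply, MonoidHom.one_apply, one_smul]

theorem symmetrize_permAct (τ : Equiv.Perm (Fin d)) (x : ⨂[k]^d V) :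
    symmetrize (permAct k d V τ x) = symmetrize x :=
  Subtype.ext ((twistedNorm_permAct 1 τ x).trans (one_smul k _))

theorem dividedPowerMap₂_symmetrize_right (B : U →ₗ[k] V →ₗ[k] W) (x : dividedPower k d U)
    (y : ⨂[k]^d V) : dividedPowerMap₂ B x (symmetrize y) = symmetrize (factorwise B x.1 y) := by
  ext
  simp only [dividedPowerMap₂_coe, symmetrize_coe, map_sum, permAct_factorwise, x.2 _]

theorem dividedPowerMap₂_symmetrize_left (B : U →ₗ[k] V →ₗ[k] W) (x : ⨂[k]^d U)
    (y : dividedPower k d V) :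
    dividedPowerMap₂ B (symmetrize x) y = symmetrize (factorwise B x y.1) := by
  ext
  simp only [dividedPowerMap₂_coe, symmetrize_coe, map_sum, LinearMap.sum_apply,
    permAct_factorwise, y.2 _]

theorem dividedPowerMap₂_symmetrize_symmetrize (B : U →ₗ[k] V →ₗ[k] W) (x : ⨂[k]^d U)
    (y : ⨂[k]^d V) : dividedPowerMap₂ B (symmetrize x) (symmetrize y) =
      ∑ ρ : Equiv.Perm (Fin d), symmetrize (factorwise B x (permAct k d V ρ y)) := by
  rw [dividedPowerMap₂_symmetrize_left, symmetrize_coe, map_sum, map_sum]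

/-! ### Tensors of rank one maps -/

/-- The rank one map `e ↦ φ e • v` attached to a vector `v` and a functional `φ`. -/
def rankOne : V →ₗ[k] Module.Dual k W →ₗ[k] (W →ₗ[k] V) :=
  LinearMap.smulRightₗ.flip

variable (k d)

/-- The tensor `e_1 ⊗ ⋯ ⊗ e_d` of the standard basis vectors of `k^d`. -/
def basisTensor : ⨂[k]^d (Fin d → k) :=
  PiTensorProduct.tprod k fun i => Pi.single i 1

/-- The tensor `e_1^* ⊗ ⋯ ⊗ e_d^*` of the coordinate functionals of `k^d`. -/
def coordTensor : ⨂[k]^d (Module.Dual k (Fin d → k)) :=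
  PiTensorProduct.tprod k fun i => LinearMap.proj i

/-- The multiplication `k^d ⊗ k^d → k^d`, sending `e_i ⊗ e_j` to `δ_{ij} e_i`. -/
def diagMap : (Fin d → k) ⊗[k] (Fin d → k) →ₗ[k] (Fin d → k) :=
  LinearMap.mul' k (Fin d → k)

variable {d}

/-- The permutation matrix sending `e_i` to `e_{τ i}`. -/
def permMatrixMap (τ : Equiv.Perm (Fin d)) : (Fin d → k) →ₗ[k] (Fin d → k) :=
  LinearMap.funLeft k k τ.symm

variable {k}

theorem permMatrixMap_single (τ : Equiv.Perm (Fin d)) (i : Fin d) :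
    permMatrixMap k τ (Pi.single i 1) = Pi.single (τ i) 1 := by
  ext j
  simp [permMatrixMap, Pi.single_apply, Equiv.symm_apply_eq]

theorem permMatrixMap_basisTensor (τ : Equiv.Perm (Fin d)) :
    tensorPowerMap (PiTensorProduct.tprod k fun _ => permMatrixMap k τ) (basisTensor k d) =
      permAct k d _ τ⁻¹ (basisTensor k d) := by
  simp only [tensorPowerMap, basisTensor, factorwise_tprod, permAct_tprod, evalBilin_apply,
    permMatrixMap_single]
  rfl

theorem coordTensor_comp_permMatrixMap (τ : Equiv.Perm (Fin d)) :
    factorwise compBilin (coordTensor k d) (PiTensorProduct.tprod k fun _ => permMatrixMap k τ) =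
      permAct k d _ τ (coordTensor k d) := by
  simp only [coordTensor, factorwise_tprod, permAct_tprod]
  rfl

theorem dualDistrib_coordTensor (ρ : Equiv.Perm (Fin d)) :
    factorwise (curry (dualDistrib k (Fin d → k) (Fin d → k)))
        (coordTensor k d) (permAct k d _ ρ (coordTensor k d)) =
      factorwise compBilin (coordTensor k d) (PiTensorProduct.tprod k fun _ =>
        diagMap k d ∘ₗ TensorProduct.map LinearMap.id (permMatrixMap k ρ)) := by
  simp only [coordTensor, factorwise_tprod, permAct_tprod]
  congr 1
  ext i : 1
  exact TensorProduct.ext' fun _ _ => rfl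

theorem permMatrixMap_comp_diagMap (τ : Equiv.Perm (Fin d)) :
    permMatrixMap k τ ∘ₗ diagMap k d =
      diagMap k d ∘ₗ TensorProduct.map (permMatrixMap k τ) (permMatrixMap k τ) :=
  TensorProduct.ext' fun _ _ => rfl

theorem factorwise_permAct_eq_ite {B : U →ₗ[k] V →ₗ[k] W} {x : Fin d → U} {y : Fin d → V}
    (h : ∀ i j, i ≠ j → B (x i) (y j) = 0) (σ : Equiv.Perm (Fin d)) :
    factorwise B (PiTensorProduct.tprod k x) (permAct k d V σ (PiTensorProduct.tprod k y)) =
      if σ = 1 then PiTensorProduct.tprod k fun i => B (x i) (y i) else 0 := by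
  rw [permAct_tprod, factorwise_tprod]
  split_ifs with hσ
  · subst hσ
    rfl
  · obtain ⟨i, hi⟩ : ∃ i, σ.symm i ≠ i := by
      by_contra! hfix
      exact hσ (inv_eq_one.mp (Equiv.ext hfix))
    exact (PiTensorProduct.tprod k).map_coord_zero i (h _ _ hi.symm)

theorem coordTensor_permAct_basisTensor (σ : Equiv.Perm (Fin d)) :
    factorwise evalBilin (coordTensor k d) (permAct k d _ σ (basisTensor k d)) =
      if σ = 1 then PiTensorProduct.tprod k fun _ => (1 : k) else 0 := by
  refine (factorwise_permAct_eq_ite (fun i j hij => ?_) σ).trans ?_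
  · exact Pi.single_eq_of_ne hij 1
  · simp

theorem diagMap_interleave_basisTensor (σ : Equiv.Perm (Fin d)) :
    tensorPowerMap (PiTensorProduct.tprod k fun _ => diagMap k d)
        (interleave k d _ _ (basisTensor k d) (permAct k d _ σ (basisTensor k d))) =
      if σ = 1 then basisTensor k d else 0 := by
  have h : tensorPowerMap (PiTensorProduct.tprod k fun _ => diagMap k d)
      (interleave k d _ _ (basisTensor k d) (permAct k d _ σ (basisTensor k d))) =
        factorwise (LinearMap.mul k (Fin d → k)) (basisTensor k d)
          (permAct k d _ σ (basisTensor k d)) := by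
    simp only [tensorPowerMap, basisTensor, interleave, permAct_tprod, factorwise_tprod]
    rfl
  rw [h, basisTensor, factorwise_permAct_eq_ite]
  · simp [← Pi.single_mul]
  · intro i j hij
    rw [LinearMap.mul_apply', ← Pi.single_mul_left, Pi.single_eq_of_ne hij, mul_zero,
      Pi.single_zero]

theorem rankOne_comp (x : ⨂[k]^d V) (φ : ⨂[k]^d (Module.Dual k W)) (g : ⨂[k]^d (U →ₗ[k] W)) :
    factorwise compBilin (factorwise rankOne x φ) g =
      factorwise rankOne x (factorwise compBilin φ g) :=
  factorwise_assoc (fun _ _ _ => rfl) x φ g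

theorem comp_rankOne (f : ⨂[k]^d (V →ₗ[k] W)) (x : ⨂[k]^d V) (φ : ⨂[k]^d (Module.Dual k U)) :
    factorwise compBilin f (factorwise rankOne x φ) =
      factorwise rankOne (tensorPowerMap f x) φ :=
  (factorwise_assoc (fun f v φ => LinearMap.ext fun e => (map_smul f (φ e) v).symm) f x φ).symm

theorem tensor_rankOne (x : ⨂[k]^d V) (φ : ⨂[k]^d (Module.Dual k U)) (y : ⨂[k]^d W)
    (ψ : ⨂[k]^d (Module.Dual k T)) :
    factorwise tensorBilin (factorwise rankOne x φ) (factorwise rankOne y ψ) =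
      factorwise rankOne (interleave k d V W x y)
        (factorwise (curry (dualDistrib k U T)) φ ψ) :=
  factorwise_interchange
    (fun v φ w ψ => TensorProduct.ext' fun e e' => (smul_tmul_smul (φ e) (ψ e') v w)) x φ y ψ

theorem rankOne_eval (x : ⨂[k]^d V) (φ : ⨂[k]^d (Module.Dual k W)) (e : ⨂[k]^d W) :
    tensorPowerMap (factorwise rankOne x φ) e =
      factorwise (LinearMap.lsmul k V).flip x (factorwise evalBilin φ e) :=
  factorwise_assoc (fun _ _ _ => rfl) x φ e

theorem factorwise_lsmul_one (x : ⨂[k]^d V) :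
    factorwise (LinearMap.lsmul k V).flip x (PiTensorProduct.tprod k fun _ => (1 : k)) = x := by
  induction x using tensor_induction with
  | h_add a b ha hb => simp only [map_add, LinearMap.add_apply, ha, hb]
  | h_smul c a ha => simp only [map_smul, LinearMap.smul_apply, ha]
  | h v => simp

/-- The invariant tensor of maps `k^d → V` attached to a tensor in `V^{⊗ d}`: for
`v_1 ⊗ ⋯ ⊗ v_d` it is the symmetrization of `e_1^* v_1 ⊗ ⋯ ⊗ e_d^* v_d`. -/
def polarize : (⨂[k]^d V) →ₗ[k] dividedPower k d ((Fin d → k) →ₗ[k] V) :=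
  symmetrize ∘ₗ (factorwise rankOne).flip (coordTensor k d)

theorem polarize_apply (x : ⨂[k]^d V) :
    polarize x = symmetrize (factorwise rankOne x (coordTensor k d)) := rfl

theorem tensorPowerMap_polarize_basisTensor (x : ⨂[k]^d V) :
    tensorPowerMap (polarize x : ⨂[k]^d ((Fin d → k) →ₗ[k] V)) (basisTensor k d) = x := by
  have h (σ : Equiv.Perm (Fin d)) :
      tensorPowerMap (permAct k d _ σ (factorwise rankOne x (coordTensor k d))) (basisTensor k d) =
        if σ = 1 then x else 0 := by
    have hσ : permAct k d _ σ (permAct k d _ σ⁻¹ (basisTensor k d)) = basisTensor k d := by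
      rw [permAct_permAct, mul_inv_cancel, permAct_one]
    rw [← hσ, tensorPowerMap, ← permAct_factorwise, ← tensorPowerMap, rankOne_eval,
      coordTensor_permAct_basisTensor]
    simp only [inv_eq_one]
    split_ifs with h
    · rw [h, permAct_one, factorwise_lsmul_one]
    · rw [map_zero, map_zero]
  rw [polarize_apply, symmetrize_coe, map_sum, LinearMap.sum_apply,
    Finset.sum_congr rfl fun σ _ => h σ, Finset.sum_ite_eq', if_pos (Finset.mem_univ _)]

theorem dividedPowerMap₂_comp_polarize (f : dividedPower k d (V →ₗ[k] W)) (x : ⨂[k]^d V) :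
    dividedPowerMap₂ compBilin f (polarize x) = polarize (tensorPowerMap f.1 x) := by
  rw [polarize_apply, dividedPowerMap₂_symmetrize_right, comp_rankOne, polarize_apply]

theorem polarize_permAct (τ : Equiv.Perm (Fin d)) (x : ⨂[k]^d V) :
    polarize (permAct k d V τ x) =
      dividedPowerMap₂ compBilin (polarize x) (dividedPowerDiag (permMatrixMap k τ⁻¹)) := by
  rw [polarize_apply, polarize_apply, dividedPowerMap₂_symmetrize_left, dividedPowerDiag_coe,
    rankOne_comp, coordTensor_comp_permMatrixMap, ← symmetrize_permAct τ (factorwise _ x _),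
    permAct_factorwise, permAct_permAct, mul_inv_cancel, permAct_one]

theorem dividedPowerMap₂_tensor_polarize (x : ⨂[k]^d V) (y : ⨂[k]^d W) :
    dividedPowerMap₂ tensorBilin (polarize x) (polarize y) =
      ∑ ρ : Equiv.Perm (Fin d), dividedPowerMap₂ compBilin
        (polarize (interleave k d V W x (permAct k d W ρ y)))
        (dividedPowerDiag (diagMap k d ∘ₗ TensorProduct.map LinearMap.id (permMatrixMap k ρ))) := by
  rw [polarize_apply, polarize_apply, dividedPowerMap₂_symmetrize_symmetrize]
  refine Finset.sum_congr rfl fun ρ _ => ?_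
  rw [permAct_factorwise, tensor_rankOne, dualDistrib_coordTensor, polarize_apply,
    dividedPowerMap₂_symmetrize_left, dividedPowerDiag_coe, rankOne_comp]

end TensorPowers

/-! ### Morphisms out of `k^d` -/

namespace DivPow

variable {k : Type u} [CommRing k] {d : ℕ} {U V W V' W' : DivPow k d}

/-- The morphism `f ⊗ ⋯ ⊗ f` of `Γ^d P_k`. -/
def diagHom (f : V.carrier →ₗ[k] W.carrier) : V ⟶ W :=
  ofTensor (dividedPowerDiag f)

@[simp]
theorem tensor_diagHom (f : V.carrier →ₗ[k] W.carrier) :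
    tensor (diagHom f) = PiTensorProduct.tprod k fun _ => f := rfl

/-- The tensor product of two objects of `Γ^d P_k`. -/
abbrev tensorObj (V W : DivPow k d) : DivPow k d := ⟨V.carrier ⊗[k] W.carrier⟩

/-- The tensor product of two morphisms of `Γ^d P_k`. -/
def tensorHom (f : V ⟶ V') (g : W ⟶ W') : tensorObj V W ⟶ tensorObj V' W' :=
  ofTensor (V := tensorObj V W) (W := tensorObj V' W')
    (dividedPowerMap₂ tensorBilin (f : Hom V V') (g : Hom W W'))

@[simp]
theorem tensor_tensorHom (f : V ⟶ V') (g : W ⟶ W') :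
    tensor (tensorHom f g) = factorwise tensorBilin (tensor f) (tensor g) := rfl

theorem tensorHom_eq_comp (f : V ⟶ V') (g : W ⟶ W') :
    tensorHom f g = tensorHom f (𝟙 W) ≫ tensorHom (𝟙 V') g := by
  ext
  rw [tensor_comp, tensor_tensorHom, tensor_tensorHom, tensor_tensorHom, ← factorwise_tensor_comp,
    ← tensor_comp, ← tensor_comp, Category.comp_id, Category.id_comp]

theorem tensorHom_smul_id (r s : k) :
    tensorHom (r • 𝟙 V) (s • 𝟙 W) = (r * s) • 𝟙 (tensorObj V W) := by
  ext
  simp [smul_smul, mul_comm]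

variable (k d) in
/-- The object `k^d` of `Γ^d P_k`. -/
abbrev stdObj : DivPow k d := ⟨Fin d → k⟩

/-- The automorphism of `k^d` in `Γ^d P_k` given by a permutation matrix. -/
def permHom (τ : Equiv.Perm (Fin d)) : stdObj k d ⟶ stdObj k d :=
  diagHom (V := stdObj k d) (W := stdObj k d) (permMatrixMap k τ)

variable (k d) in
/-- The morphism `k^d ⊗ k^d → k^d` of `Γ^d P_k` sending `e_i ⊗ e_j` to `δ_{ij} e_i`. -/
def diagonal : tensorObj (stdObj k d) (stdObj k d) ⟶ stdObj k d :=
  diagHom (V := tensorObj (stdObj k d) (stdObj k d)) (W := stdObj k d) (diagMap k d)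

theorem diagonal_permHom (τ : Equiv.Perm (Fin d)) :
    diagonal k d ≫ permHom τ = tensorHom (permHom τ) (permHom τ) ≫ diagonal k d := by
  ext
  simp [diagonal, permHom, permMatrixMap_comp_diagMap]

/-- The morphism `k^d → V` of `Γ^d P_k` that sends `e_1 ⊗ ⋯ ⊗ e_d` to a given tensor
in `V^{⊗ d}` and comes from `polarize`. -/
def classify (V : DivPow k d) : (⨂[k]^d V.carrier) →ₗ[k] (stdObj k d ⟶ V) :=
  polarize

theorem tensorPowerMap_classify_basisTensor (x : ⨂[k]^d V.carrier) :
    tensorPowerMap (tensor (classify V x)) (basisTensor k d) = x :=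
  tensorPowerMap_polarize_basisTensor x

theorem classify_comp (x : ⨂[k]^d V.carrier) (f : V ⟶ W) :
    classify V x ≫ f = classify W (tensorPowerMap (tensor f) x) :=
  dividedPowerMap₂_comp_polarize f x

theorem classify_permAct (τ : Equiv.Perm (Fin d)) (x : ⨂[k]^d V.carrier) :
    classify V (permAct k d _ τ x) = permHom τ⁻¹ ≫ classify V x :=
  polarize_permAct τ x

theorem tensorHom_classify (x : ⨂[k]^d V.carrier) (y : ⨂[k]^d W.carrier) :
    tensorHom (classify V x) (classify W y) =
      ∑ ρ : Equiv.Perm (Fin d), (tensorHom (𝟙 (stdObj k d)) (permHom ρ) ≫ diagonal k d) ≫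
          classify (tensorObj V W) (interleave k d _ _ x (permAct k d _ ρ y)) := by
  have h (ρ : Equiv.Perm (Fin d)) : tensorHom (𝟙 (stdObj k d)) (permHom ρ) ≫ diagonal k d =
      diagHom (V := tensorObj (stdObj k d) (stdObj k d)) (W := stdObj k d)
        (diagMap k d ∘ₗ TensorProduct.map LinearMap.id (permMatrixMap k ρ)) := by
    ext
    simp [permHom, diagonal]
  simp only [h]
  exact dividedPowerMap₂_tensor_polarize x y

end DivPow

/-! ### The universal property of the internal tensor product -/

section IteratedColimit

universe v v₁ v₂ w w₁ w₂

variable {J : Type w₁} [Category.{v₁} J] {K : Type w₂} [Category.{v₂} K] {C : Type w}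
  [Category.{v} C] [HasColimitsOfShape J C] [HasColimitsOfShape K C] (D : J ⥤ K ⥤ C) {Z : C}

/-- The structure maps of an iterated colimit. -/
def iteratedColimitι (p : J) (q : K) : (D.obj p).obj q ⟶ colimit (D ⋙ colim) :=
  colimit.ι (D.obj p) q ≫ colimit.ι (D ⋙ colim) p

theorem map_iteratedColimitι_left {p p' : J} (a : p ⟶ p') (q : K) :
    (D.map a).app q ≫ iteratedColimitι D p' q = iteratedColimitι D p q := by
  rw [iteratedColimitι, iteratedColimitι, ← colimit.w (D ⋙ colim) a]
  exact (ι_colimMap_assoc (D.map a) q _).symm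

theorem map_iteratedColimitι_right (p : J) {q q' : K} (b : q ⟶ q') :
    (D.obj p).map b ≫ iteratedColimitι D p q' = iteratedColimitι D p q :=
  colimit.w_assoc (D.obj p) b _

variable {D}

theorem existsUnique_iteratedColimit_desc (c : ∀ p q, (D.obj p).obj q ⟶ Z)
    (left : ∀ {p p'} (a : p ⟶ p') q, (D.map a).app q ≫ c p' q = c p q)
    (right : ∀ p {q q'} (b : q ⟶ q'), (D.obj p).map b ≫ c p q' = c p q) :
    ∃! m : colimit (D ⋙ colim) ⟶ Z, ∀ p q, iteratedColimitι D p q ≫ m = c p q := by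
  let inner (p : J) : Cocone (D.obj p) :=
    { pt := Z
      ι := { app := c p, naturality := fun _ _ b => (right p b).trans (Category.comp_id _).symm } }
  let outer : Cocone (D ⋙ colim) :=
    { pt := Z
      ι :=
        { app := fun p => colimit.desc _ (inner p)
          naturality := fun p p' a => colimit.hom_ext fun q => by
            simp [inner, left] } }
  refine ⟨colimit.desc _ outer, fun p q => ?_, fun m hm => ?_⟩
  · simp [iteratedColimitι, outer, inner]
  · refine colimit.hom_ext fun p => colimit.hom_ext fun q => ?_
    simpa [iteratedColimitι, outer, inner] using hm p q

end IteratedColimit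

variable {k : Type u} [CommRing k] {d : ℕ}

namespace RepGamma

section Act

variable (Z : RepGamma k d) {U V W : DivPow k d}

/-- The action of the morphisms of `Γ^d P_k` on a strict polynomial functor. -/
def act : (V ⟶ W) →ₗ[k] (Z.obj.obj V →ₗ[k] Z.obj.obj W) where
  toFun f := (Z.obj.map f).hom
  map_add' _ _ := congrArg ModuleCat.Hom.hom Z.property.1.map_add
  map_smul' r f := congrArg ModuleCat.Hom.hom (Z.property.2.map_smul f r)

theorem act_id (x : Z.obj.obj V) : Z.act (𝟙 V) x = x :=
  congrArg (fun f => ModuleCat.Hom.hom f x) (Z.obj.map_id V)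

theorem act_comp (f : U ⟶ V) (g : V ⟶ W) (x : Z.obj.obj U) :
    Z.act (f ≫ g) x = Z.act g (Z.act f x) :=
  congrArg (fun f => ModuleCat.Hom.hom f x) (Z.obj.map_comp f g)

end Act

variable {X Y : RepGamma k d} {V W : DivPow k d}

/-- The component at `V` of a morphism of strict polynomial functors, as a linear map. -/
def app (m : X ⟶ Y) (V : DivPow k d) : X.obj.obj V →ₗ[k] Y.obj.obj V :=
  (m.hom.app V).hom

theorem app_act (m : X ⟶ Y) (f : V ⟶ W) (x : X.obj.obj V) :
    app m W (X.act f x) = Y.act f (app m V x) :=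
  LinearMap.congr_fun (congrArg ModuleCat.Hom.hom (m.hom.naturality f)) x

theorem hom_ext_app {m n : X ⟶ Y} (h : ∀ V x, app m V x = app n V x) : m = n := by
  apply ObjectProperty.hom_ext
  ext V x
  exact h V x

/-- Construct a morphism of strict polynomial functors from its components. -/
def mkHom (m : ∀ V, X.obj.obj V →ₗ[k] Y.obj.obj V)
    (h : ∀ {V W : DivPow k d} (f : V ⟶ W) x, m W (X.act f x) = Y.act f (m V x)) : X ⟶ Y :=
  ObjectProperty.homMk
    { app := fun V => ModuleCat.ofHom (m V)
      naturality := fun _ _ f => ModuleCat.hom_ext (LinearMap.ext (h f)) }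

theorem app_eq_act (α : (representable k d).obj (op V) ⟶ X) (f : V ⟶ W) :
    app α W f = X.act f (app α V (𝟙 V)) :=
  (congrArg (app α W) (Category.id_comp f).symm).trans (app_act α f (𝟙 V))

/-- The Yoneda bijection `Hom(Γ^{d,V}, X) ≃ X(V)`. -/
def elementEquiv : ((representable k d).obj (op V) ⟶ X) ≃ X.obj.obj V where
  toFun α := app α V (𝟙 V)
  invFun x := mkHom (fun W => (X.act.flip x : (V ⟶ W) →ₗ[k] X.obj.obj W))
    (fun f g => X.act_comp g f x)
  left_inv α := hom_ext_app fun _ f => (app_eq_act α f).symm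
  right_inv x := X.act_id x

theorem elementEquiv_map_comp (f : V ⟶ W) (α : (representable k d).obj (op V) ⟶ X) :
    elementEquiv ((representable k d).map f.op ≫ α) = X.act f (elementEquiv α) :=
  (congrArg (app α W) (Category.comp_id f)).trans (app_eq_act α f)

theorem map_comp_elementEquiv_symm (f : V ⟶ W) (x : X.obj.obj V) :
    (representable k d).map f.op ≫ elementEquiv.symm x = elementEquiv.symm (X.act f x) := by
  rw [Equiv.eq_symm_apply, elementEquiv_map_comp, Equiv.apply_symm_apply]

end RepGamma

open RepGamma

/-- A family of maps `X(V) × Y(W) → Z(V ⊗ W)` natural in `V` and `W`, that is, a cocone on the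
diagram of `X ⊗ Y`. As that diagram is indexed by the elements of `X` and `Y`, bilinearity is not
part of the notion. -/
@[ext]
structure NaturalPairing (X Y Z : RepGamma k d) where
  toFun : ∀ {V W : DivPow k d}, X.obj.obj V → Y.obj.obj W → Z.obj.obj (DivPow.tensorObj V W)
  natural : ∀ {V V' W W' : DivPow k d} (f : V ⟶ V') (g : W ⟶ W') (x : X.obj.obj V)
    (y : Y.obj.obj W), toFun (X.act f x) (Y.act g y) = Z.act (DivPow.tensorHom f g) (toFun x y)

namespace NaturalPairing

variable {X Y Z Z' : RepGamma k d} {V W : DivPow k d}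

/-- The composition of a pairing with a morphism of its target. -/
def postcomp (φ : NaturalPairing X Y Z) (m : Z ⟶ Z') : NaturalPairing X Y Z' where
  toFun x y := app m _ (φ.toFun x y)
  natural f g x y := by rw [φ.natural, app_act]

theorem map_smul (φ : NaturalPairing X Y Z) (r s : k) (x : X.obj.obj V) (y : Y.obj.obj W) :
    φ.toFun (r • x) (s • y) = (r * s) • φ.toFun x y := by
  have h := φ.natural (r • 𝟙 V) (s • 𝟙 W) x y
  simpa only [DivPow.tensorHom_smul_id, _root_.map_smul, LinearMap.smul_apply, act_id] using h

/-- A pairing is universal if every pairing factors uniquely through it. -/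
def IsUniversal (φ : NaturalPairing X Y Z) : Prop :=
  ∀ (Z' : RepGamma k d) (z : NaturalPairing X Y Z'), ∃! m : Z ⟶ Z', φ.postcomp m = z

theorem IsUniversal.nonempty_iso {φ : NaturalPairing X Y Z} (h : φ.IsUniversal)
    {φ' : NaturalPairing X Y Z'} (h' : φ'.IsUniversal) : Nonempty (Z ≅ Z') := by
  obtain ⟨m, hm, -⟩ := h Z' φ'
  obtain ⟨n, hn, -⟩ := h' Z φ
  refine ⟨⟨m, n, (h Z φ).unique ?_ rfl, (h' Z' φ').unique ?_ rfl⟩⟩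
  · change (φ.postcomp m).postcomp n = φ
    rw [hm, hn]
  · change (φ'.postcomp n).postcomp m = φ'
    rw [hn, hm]

end NaturalPairing

section InternalTensor

variable (X Y : RepGamma k d)

/-- The structure map `Γ^{d, V ⊗ W} → X ⊗ Y` attached to `Γ^{d, V} → X` and `Γ^{d, W} → Y`. -/
def internalTensorι (p : RepresentablesOver X) (q : RepresentablesOver Y) :
    (representable k d).obj (op (DivPow.tensorObj p.left.unop q.left.unop)) ⟶ internalTensor X Y :=
  iteratedColimitι (internalTensorDiagram X Y) p q

theorem map_internalTensorι {p p' : RepresentablesOver X} (a : p ⟶ p')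
    {q q' : RepresentablesOver Y} (b : q ⟶ q') :
    (representable k d).map (DivPow.tensorHom a.left.unop b.left.unop).op ≫
      internalTensorι X Y p' q' = internalTensorι X Y p q := by
  rw [DivPow.tensorHom_eq_comp, op_comp, Functor.map_comp, Category.assoc]
  refine Eq.trans (congrArg _ ?_) (map_iteratedColimitι_right (internalTensorDiagram X Y) p b)
  exact map_iteratedColimitι_left (internalTensorDiagram X Y) a q'

variable {X Y}

/-- The object `Γ^{d,V} → X` of `RepresentablesOver X` given by an element of `X(V)`. -/
abbrev overElement {V : DivPow k d} (x : X.obj.obj V) : RepresentablesOver X :=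
  CostructuredArrow.mk (elementEquiv.symm x)

/-- The morphism of `RepresentablesOver X` from `f x` to `x` given by `f`. -/
def overElementMap {V V' : DivPow k d} (f : V ⟶ V') (x : X.obj.obj V) :
    overElement (X.act f x) ⟶ overElement x :=
  CostructuredArrow.homMk f.op (map_comp_elementEquiv_symm f x)

theorem act_elementEquiv_hom {p p' : RepresentablesOver X} (a : p ⟶ p') :
    X.act a.left.unop (elementEquiv (V := p'.left.unop) p'.hom) =
      elementEquiv (V := p.left.unop) p.hom :=
  (elementEquiv_map_comp a.left.unop p'.hom).symm.trans
    (congrArg elementEquiv (CostructuredArrow.w a))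

theorem exists_eq_overElement (p : RepresentablesOver X) :
    ∃ (V : DivPow k d) (x : X.obj.obj V), p = overElement x := by
  obtain ⟨V, ⟨⟨⟩⟩, α⟩ := p
  exact ⟨V.unop, elementEquiv α,
    congrArg CostructuredArrow.mk (elementEquiv.symm_apply_apply α).symm⟩

variable (X Y) in
/-- The canonical pairing with values in the internal tensor product. -/
def internalTensorPairing : NaturalPairing X Y (internalTensor X Y) where
  toFun {V W} x y :=
    elementEquiv (V := DivPow.tensorObj V W) (internalTensorι X Y (overElement x) (overElement y))
  natural f g x y :=
    (congrArg elementEquiv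
      (map_internalTensorι X Y (overElementMap f x) (overElementMap g y)).symm).trans
      (elementEquiv_map_comp (DivPow.tensorHom f g) _)

theorem internalTensorPairing_postcomp_eq_iff {Z : RepGamma k d} (z : NaturalPairing X Y Z)
    (m : internalTensor X Y ⟶ Z) :
    (internalTensorPairing X Y).postcomp m = z ↔
      ∀ p q, internalTensorι X Y p q ≫ m =
        (elementEquiv (V := DivPow.tensorObj p.left.unop q.left.unop)).symm
          (z.toFun (V := p.left.unop) (W := q.left.unop)
            (elementEquiv p.hom) (elementEquiv q.hom)) := by
  have h {V W : DivPow k d} (x : X.obj.obj V) (y : Y.obj.obj W) :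
      z.toFun (elementEquiv (elementEquiv.symm x)) (elementEquiv (elementEquiv.symm y)) =
        z.toFun x y := by
    rw [elementEquiv.apply_symm_apply, elementEquiv.apply_symm_apply]
  constructor
  · rintro rfl p q
    obtain ⟨V, x, rfl⟩ := exists_eq_overElement p
    obtain ⟨W, y, rfl⟩ := exists_eq_overElement q
    exact (Equiv.eq_symm_apply _).mpr (h x y).symm
  · intro hm
    ext V W x y
    exact ((Equiv.eq_symm_apply _).mp (hm (overElement x) (overElement y))).trans (h x y)

theorem internalTensorPairing_isUniversal : (internalTensorPairing X Y).IsUniversal := by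
  intro Z z
  refine (existsUnique_congr (internalTensorPairing_postcomp_eq_iff z)).mpr ?_
  refine existsUnique_iteratedColimit_desc (D := internalTensorDiagram X Y) _ ?_ ?_
  · intro p p' a q
    refine (map_comp_elementEquiv_symm (DivPow.tensorHom a.left.unop (𝟙 q.left.unop)) _).trans ?_
    rw [← z.natural, act_elementEquiv_hom, act_id]
  · intro p q q' b
    refine (map_comp_elementEquiv_symm (DivPow.tensorHom (𝟙 p.left.unop) b.left.unop) _).trans ?_
    rw [← z.natural, act_elementEquiv_hom, act_id]

end InternalTensor

/-! ### Quotients of the tensor power functor -/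

open DivPow

/-- A presentation of a strict polynomial functor as a quotient of `V ↦ V^{⊗ d}`. -/
structure TensorQuotient (X : RepGamma k d) where
  proj : ∀ V : DivPow k d, (⨂[k]^d V.carrier) →ₗ[k] X.obj.obj V
  surjective : ∀ V, Function.Surjective (proj V)
  natural : ∀ {V W : DivPow k d} (f : V ⟶ W) (x : ⨂[k]^d V.carrier),
    proj W (tensorPowerMap (tensor f) x) = X.act f (proj V x)

/-- The submodule of `V^{⊗ d}` spanned by all `σ x - θ(σ) x`. -/
def twistedRelations (θ : Equiv.Perm (Fin d) →* k) (V : DivPow k d) :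
    Submodule k (⨂[k]^d V.carrier) :=
  Submodule.span k {y | ∃ (σ : Equiv.Perm (Fin d)) (x : ⨂[k]^d V.carrier),
    y = permAct k d V.carrier σ x - θ σ • x}

theorem twistedRelations_le_ker_iff {θ : Equiv.Perm (Fin d) →* k} {V : DivPow k d}
    {N : Type*} [AddCommGroup N] [Module k N] {g : (⨂[k]^d V.carrier) →ₗ[k] N} :
    twistedRelations θ V ≤ LinearMap.ker g ↔
      ∀ σ x, g (permAct k d V.carrier σ x) = θ σ • g x := by
  simp only [twistedRelations, Submodule.span_le, Set.subset_def, Set.mem_ofPred_eq,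
    forall_exists_index, SetLike.mem_coe, LinearMap.mem_ker]
  refine ⟨fun h σ x => ?_, ?_⟩
  · rw [← sub_eq_zero, ← map_smul, ← map_sub]
    exact h _ σ x rfl
  · rintro h _ σ x rfl
    rw [map_sub, map_smul, h, sub_self]

namespace TensorQuotient

variable {X Y S Z : RepGamma k d} {V W : DivPow k d}

section Lift

variable (qX : TensorQuotient X) {N : Type*} [AddCommGroup N] [Module k N]
  (g : (⨂[k]^d V.carrier) →ₗ[k] N) (h : LinearMap.ker (qX.proj V) ≤ LinearMap.ker g)

/-- The factorization through `X(V)` of a linear map on `V^{⊗ d}` that kills the relations. -/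
def lift : X.obj.obj V →ₗ[k] N :=
  (LinearMap.ker (qX.proj V)).liftQ g h ∘ₗ
    ((qX.proj V).quotKerEquivOfSurjective (qX.surjective V)).symm.toLinearMap

@[simp]
theorem lift_proj (x : ⨂[k]^d V.carrier) : qX.lift g h (qX.proj V x) = g x := by
  rw [lift, LinearMap.comp_apply, LinearEquiv.coe_coe,
    LinearMap.quotKerEquivOfSurjective_symm_apply, Submodule.liftQ_apply]

end Lift

section Generator

variable (qX : TensorQuotient X)

/-- The class of `e_1 ⊗ ⋯ ⊗ e_d`, which generates the quotient as a strict polynomial functor. -/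
def generator : X.obj.obj (stdObj k d) :=
  qX.proj (stdObj k d) (basisTensor k d)

theorem act_classify_generator (x : ⨂[k]^d V.carrier) :
    X.act (classify V x) qX.generator = qX.proj V x := by
  rw [generator, ← qX.natural, tensorPowerMap_classify_basisTensor]

theorem hom_ext_generator {m n : X ⟶ Z} (h : app m _ qX.generator = app n _ qX.generator) :
    m = n :=
  hom_ext_app fun V x => by
    obtain ⟨x, rfl⟩ := qX.surjective V x
    rw [← act_classify_generator, app_act, app_act, h]

/-- The morphism sending the generator to an element that satisfies the relations of the
quotient. -/
def desc (ζ : Z.obj.obj (stdObj k d))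
    (h : ∀ V, LinearMap.ker (qX.proj V) ≤ LinearMap.ker (Z.act.flip ζ ∘ₗ classify V)) : X ⟶ Z :=
  mkHom (fun V => qX.lift (Z.act.flip ζ ∘ₗ classify V) (h V)) fun {V W} f x => by
    obtain ⟨x, rfl⟩ := qX.surjective V x
    rw [← qX.natural, lift_proj, lift_proj, LinearMap.comp_apply, LinearMap.comp_apply,
      LinearMap.flip_apply, LinearMap.flip_apply, ← classify_comp, act_comp]

theorem desc_proj (ζ : Z.obj.obj (stdObj k d))
    (h : ∀ V, LinearMap.ker (qX.proj V) ≤ LinearMap.ker (Z.act.flip ζ ∘ₗ classify V))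
    (x : ⨂[k]^d V.carrier) :
    app (qX.desc ζ h) V (qX.proj V x) = Z.act (classify V x) ζ :=
  qX.lift_proj _ (h V) x

end Generator

/-- The symmetric group acts on the quotient through the character `χ`. -/
def IsEquivariant (qX : TensorQuotient X) (χ : Equiv.Perm (Fin d) →* k) : Prop :=
  ∀ (V : DivPow k d) (σ : Equiv.Perm (Fin d)) (x : ⨂[k]^d V.carrier),
    qX.proj V (permAct k d V.carrier σ x) = χ σ • qX.proj V x

/-- The quotient lies between the `χ`-twisted coinvariants of `V^{⊗ d}` and the image of the
`χ`-twisted norm. -/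
structure IsTwisted (qX : TensorQuotient X) (χ : Equiv.Perm (Fin d) →* k) : Prop where
  isEquivariant : qX.IsEquivariant χ
  ker_le_ker_twistedNorm : ∀ V, LinearMap.ker (qX.proj V) ≤ LinearMap.ker (twistedNorm χ)

/-- The quotient consists of the `θ`-twisted coinvariants of `V^{⊗ d}`. -/
def IsCoinvariants (qX : TensorQuotient X) (θ : Equiv.Perm (Fin d) →* k) : Prop :=
  ∀ V, LinearMap.ker (qX.proj V) = twistedRelations θ V

variable {qX : TensorQuotient X} {qY : TensorQuotient Y} {qS : TensorQuotient S}
  {χ ψ θ : Equiv.Perm (Fin d) →* k}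

theorem IsCoinvariants.ker_proj_le_ker_iff (h : qX.IsCoinvariants θ) {N : Type*}
    [AddCommGroup N] [Module k N] {g : (⨂[k]^d V.carrier) →ₗ[k] N} :
    LinearMap.ker (qX.proj V) ≤ LinearMap.ker g ↔
      ∀ σ x, g (permAct k d V.carrier σ x) = θ σ • g x := by
  rw [h V, twistedRelations_le_ker_iff]

theorem IsCoinvariants.isEquivariant (h : qX.IsCoinvariants θ) : qX.IsEquivariant θ :=
  fun _ => h.ker_proj_le_ker_iff.mp le_rfl

theorem IsCoinvariants.isTwisted (h : qX.IsCoinvariants θ) : qX.IsTwisted θ where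
  isEquivariant := h.isEquivariant
  ker_le_ker_twistedNorm _ := h.ker_proj_le_ker_iff.mpr (twistedNorm_permAct θ)

theorem IsEquivariant.act_permHom_generator (h : qX.IsEquivariant χ) (τ : Equiv.Perm (Fin d)) :
    X.act (permHom τ) qX.generator = χ τ⁻¹ • qX.generator := by
  rw [generator, ← qX.natural, permHom, tensor_diagHom, permMatrixMap_basisTensor, h]

/-- The twisted norm, as a map `Y(W) → W^{⊗ d}`. -/
def IsTwisted.norm (hY : qY.IsTwisted ψ) (W : DivPow k d) :
    Y.obj.obj W →ₗ[k] ⨂[k]^d W.carrier :=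
  qY.lift (twistedNorm ψ) (hY.ker_le_ker_twistedNorm W)

theorem IsTwisted.norm_proj (hY : qY.IsTwisted ψ) (y : ⨂[k]^d W.carrier) :
    hY.norm W (qY.proj W y) = twistedNorm ψ y :=
  qY.lift_proj _ _ y

/-- Modulo the diagonal action of `S_d`, twisted norms can be moved across `⊗`. -/
theorem IsEquivariant.proj_interleave_twistedNorm (hS : qS.IsEquivariant (χ * ψ))
    (x : ⨂[k]^d V.carrier) (y : ⨂[k]^d W.carrier) :
    qS.proj (tensorObj V W) (interleave k d _ _ x (twistedNorm ψ y)) =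
      qS.proj (tensorObj V W) (interleave k d _ _ (twistedNorm χ x) y) := by
  simp only [twistedNorm_apply, map_sum, map_smul, LinearMap.sum_apply, LinearMap.smul_apply]
  refine Fintype.sum_equiv (Equiv.inv _) _ _ fun ρ => ?_
  have h : permAct k d _ ρ (interleave k d _ _ (permAct k d _ ρ⁻¹ x) y) =
      interleave k d V.carrier W.carrier x (permAct k d _ ρ y) := by
    rw [permAct_interleave, permAct_permAct, mul_inv_cancel, permAct_one]
  rw [← h, hS, smul_smul, Equiv.inv_apply, inv_inv, MonoidHom.mul_apply, mul_comm (χ ρ),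
    ← mul_assoc, ← map_mul, inv_mul_cancel, map_one, one_mul]

section Pairing

variable (hX : qX.IsTwisted χ) (hY : qY.IsTwisted ψ) (hS : qS.IsEquivariant (χ * ψ))

/-- The map `X(V) × Y(W) → S(V ⊗ W)` induced by `(x, y) ↦ x ⊗ N y`, where `N` is the twisted
norm. -/
def pairingMap (V W : DivPow k d) :
    X.obj.obj V →ₗ[k] Y.obj.obj W →ₗ[k] S.obj.obj (tensorObj V W) :=
  qX.lift
    (((interleave k d V.carrier W.carrier).compr₂ (qS.proj (tensorObj V W))).compl₂ (hY.norm W))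
    fun x hx => LinearMap.ext fun y => by
      obtain ⟨y, rfl⟩ := qY.surjective W y
      rw [LinearMap.compl₂_apply, LinearMap.compr₂_apply, hY.norm_proj,
        hS.proj_interleave_twistedNorm, LinearMap.mem_ker.mp (hX.ker_le_ker_twistedNorm V hx),
        map_zero, LinearMap.zero_apply, map_zero, LinearMap.zero_apply]

theorem pairingMap_proj (x : ⨂[k]^d V.carrier) (y : ⨂[k]^d W.carrier) :
    pairingMap hX hY hS V W (qX.proj V x) (qY.proj W y) =
      qS.proj (tensorObj V W) (interleave k d _ _ x (twistedNorm ψ y)) :=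
  (LinearMap.congr_fun (qX.lift_proj _ _ x) _).trans
    (congrArg (qS.proj (tensorObj V W) ∘ interleave k d _ _ x) (hY.norm_proj y))

/-- The natural pairing with components `pairingMap`. -/
def pairing : NaturalPairing X Y S where
  toFun {V W} x y := pairingMap hX hY hS V W x y
  natural {V V' W W'} f g x y := by
    obtain ⟨x, rfl⟩ := qX.surjective V x
    obtain ⟨y, rfl⟩ := qY.surjective W y
    rw [← qX.natural, ← qY.natural, pairingMap_proj, pairingMap_proj, ← qS.natural,
      tensor_tensorHom, tensorPowerMap_interleave, tensorPowerMap_twistedNorm ψ (tensor_mem g)]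

theorem pairing_proj (x : ⨂[k]^d V.carrier) (y : ⨂[k]^d W.carrier) :
    (pairing hX hY hS).toFun (qX.proj V x) (qY.proj W y) =
      qS.proj (tensorObj V W) (interleave k d _ _ x (twistedNorm ψ y)) :=
  pairingMap_proj hX hY hS x y

end Pairing

/-- The image of the pair of generators of `X` and `Y` under
`X(k^d) × Y(k^d) → Z(k^d ⊗ k^d) → Z(k^d)`, which determines the pairing `z`. -/
def diagonalValue (qX : TensorQuotient X) (qY : TensorQuotient Y) (z : NaturalPairing X Y Z) :
    Z.obj.obj (stdObj k d) :=
  Z.act (diagonal k d) (z.toFun qX.generator qY.generator)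

variable (hX : qX.IsTwisted χ) (hY : qY.IsTwisted ψ) (z : NaturalPairing X Y Z)

include hX hY in
theorem act_classify_permAct_diagonalValue (τ : Equiv.Perm (Fin d)) (x : ⨂[k]^d V.carrier) :
    Z.act (classify V (permAct k d V.carrier τ x)) (diagonalValue qX qY z) =
      (χ * ψ) τ • Z.act (classify V x) (diagonalValue qX qY z) := by
  have hζ : Z.act (permHom τ⁻¹) (diagonalValue qX qY z) = (χ * ψ) τ • diagonalValue qX qY z := by
    rw [diagonalValue, ← act_comp, diagonal_permHom, act_comp, ← z.natural,
      hX.isEquivariant.act_permHom_generator, hY.isEquivariant.act_permHom_generator,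
      z.map_smul, map_smul, inv_inv, MonoidHom.mul_apply]
  rw [classify_permAct, act_comp, hζ, map_smul]

include hY in
theorem toFun_proj_eq_act_classify_diagonalValue (x : ⨂[k]^d V.carrier)
    (y : ⨂[k]^d W.carrier) :
    z.toFun (qX.proj V x) (qY.proj W y) =
      Z.act (classify (tensorObj V W) (interleave k d _ _ x (twistedNorm ψ y)))
        (diagonalValue qX qY z) := by
  have h (ρ : Equiv.Perm (Fin d)) :
      Z.act (tensorHom (𝟙 (stdObj k d)) (permHom ρ) ≫ diagonal k d)
        (z.toFun qX.generator qY.generator) = ψ ρ⁻¹ • diagonalValue qX qY z := by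
    have hs := z.map_smul 1 (ψ ρ⁻¹) qX.generator qY.generator
    rw [one_smul, one_mul] at hs
    rw [act_comp, ← z.natural, act_id, hY.isEquivariant.act_permHom_generator, hs, map_smul,
      diagonalValue]
  rw [← qX.act_classify_generator, ← qY.act_classify_generator, z.natural, tensorHom_classify,
    twistedNorm_apply]
  simp only [map_sum, map_smul, LinearMap.sum_apply, LinearMap.smul_apply,
    act_comp _ _ (classify _ _), h]

theorem diagonalValue_pairing (hS : qS.IsEquivariant (χ * ψ)) :
    diagonalValue qX qY (pairing hX hY hS) = qS.generator := by
  rw [diagonalValue, generator, generator, pairing_proj, ← qS.natural, diagonal, tensor_diagHom,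
    twistedNorm_apply]
  simp only [map_sum, map_smul, diagMap_interleave_basisTensor]
  rw [Finset.sum_eq_single 1 (fun ρ _ hρ => by rw [if_neg hρ, map_zero, smul_zero])
    (fun h => absurd (Finset.mem_univ _) h), if_pos rfl, inv_one, map_one, one_smul, generator]

theorem diagonalValue_postcomp_pairing (hS : qS.IsEquivariant (χ * ψ)) (m : S ⟶ Z) :
    diagonalValue qX qY ((pairing hX hY hS).postcomp m) = app m _ qS.generator := by
  rw [← diagonalValue_pairing hX hY hS]
  exact (app_act m _ _).symm

theorem pairing_isUniversal (hS : qS.IsCoinvariants (χ * ψ)) :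
    (pairing hX hY hS.isEquivariant).IsUniversal := by
  intro Z z
  let ζ := diagonalValue qX qY z
  have hζ (V : DivPow k d) :
      LinearMap.ker (qS.proj V) ≤ LinearMap.ker (Z.act.flip ζ ∘ₗ classify V) :=
    hS.ker_proj_le_ker_iff.mpr (act_classify_permAct_diagonalValue hX hY z)
  refine existsUnique_of_exists_of_unique ⟨qS.desc ζ hζ, ?_⟩ fun m n hm hn => ?_
  · ext V W x y
    obtain ⟨x, rfl⟩ := qX.surjective V x
    obtain ⟨y, rfl⟩ := qY.surjective W y
    change app (qS.desc ζ hζ) _ ((pairing hX hY hS.isEquivariant).toFun _ _) = _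
    rw [pairing_proj, desc_proj, toFun_proj_eq_act_classify_diagonalValue hY]
  · apply qS.hom_ext_generator
    rw [← diagonalValue_postcomp_pairing hX hY hS.isEquivariant m, hm,
      ← diagonalValue_postcomp_pairing hX hY hS.isEquivariant n, hn]

include hX hY in
theorem IsTwisted.nonempty_internalTensor_iso (h : χ * ψ = θ) (hS : qS.IsCoinvariants θ) :
    Nonempty (internalTensor X Y ≅ S) := by
  subst h
  exact internalTensorPairing_isUniversal.nonempty_iso (pairing_isUniversal hX hY hS)

end TensorQuotient

/-! ### Symmetric and exterior powers -/

/-- The sign character of the symmetric group, with values in `k`. -/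
def signChar (k : Type u) [CommRing k] {d : ℕ} : Equiv.Perm (Fin d) →* k :=
  (Int.castRingHom k).toMonoidHom.comp ((Units.coeHom ℤ).comp Equiv.Perm.sign)

theorem signChar_apply (σ : Equiv.Perm (Fin d)) :
    signChar k σ = ((Equiv.Perm.sign σ : ℤ) : k) := rfl

theorem signChar_inv (σ : Equiv.Perm (Fin d)) : signChar k σ⁻¹ = signChar k σ := by
  rw [signChar_apply, signChar_apply, Equiv.Perm.sign_inv]

theorem signChar_mul_signChar : signChar k * signChar k = (1 : Equiv.Perm (Fin d) →* k) := by
  ext σ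
  rw [MonoidHom.mul_apply, MonoidHom.one_apply]
  nth_rw 1 [← signChar_inv]
  rw [← map_mul, inv_mul_cancel, map_one]

theorem signChar_eq_one (h2 : (2 : k) = 0) : signChar k = (1 : Equiv.Perm (Fin d) →* k) := by
  ext σ
  have h : (-1 : k) = 1 := by
    rw [neg_eq_iff_add_eq_zero, one_add_one_eq_two, h2]
  rcases Int.units_eq_one_or (Equiv.Perm.sign σ) with hσ | hσ <;> simp [signChar_apply, hσ, h]

theorem twistedNorm_signChar {V : Type u} [AddCommGroup V] [Module k V] (x : ⨂[k]^d V) :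
    twistedNorm (signChar k) x = exteriorPower.toTensorPower k V d (wedgeProj k d V x) := by
  simp only [twistedNorm_apply, toTensorPower_wedgeProj, signChar_apply, Equiv.Perm.sign_inv]

theorem wedgeProj_permAct {V : Type u} [AddCommGroup V] [Module k V] (σ : Equiv.Perm (Fin d))
    (x : ⨂[k]^d V) : wedgeProj k d V (permAct k d V σ x) = signChar k σ • wedgeProj k d V x := by
  induction x using tensor_induction with
  | h_add a b ha hb => simp only [map_add, ha, hb, smul_add]
  | h_smul c a ha => simp only [map_smul, ha, smul_comm c]
  | h v =>
    rw [permAct_tprod, wedgeProj_tprod, wedgeProj_tprod, ← signChar_inv]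
    exact (AlternatingMap.map_perm (exteriorPower.ιMulti k d) v σ⁻¹).trans
      (Int.cast_smul_eq_zsmul k _ _).symm

/-- When `2` is invertible, antisymmetric multilinear maps are alternating, hence factor through
the exterior power. -/
theorem ker_wedgeProj_le_ker (h2 : IsUnit (2 : k)) {V N : Type u} [AddCommGroup V] [Module k V]
    [AddCommGroup N] [Module k N] {g : (⨂[k]^d V) →ₗ[k] N}
    (hg : ∀ σ x, g (permAct k d V σ x) = signChar k σ • g x) :
    LinearMap.ker (wedgeProj k d V) ≤ LinearMap.ker g := by
  let a : V [⋀^Fin d]→ₗ[k] N :=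
    { g.compMultilinearMap (PiTensorProduct.tprod k) with
      map_eq_zero_of_eq' := fun v i j hv hij => by
        have hswap : permAct k d V (Equiv.swap i j) (PiTensorProduct.tprod k v) =
            PiTensorProduct.tprod k v := by
          rw [permAct_tprod, Equiv.symm_swap]
          congr 1
          exact funext fun l => Equiv.apply_swap_eq_self hv l
        have hneg : g (PiTensorProduct.tprod k v) = -g (PiTensorProduct.tprod k v) := by
          simpa [hswap, signChar_apply, Equiv.Perm.sign_swap hij] using
            hg (Equiv.swap i j) (PiTensorProduct.tprod k v)
        refine h2.smul_eq_zero.mp ((two_smul k _).trans ?_)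
        exact eq_neg_iff_add_eq_zero.mp hneg }
  have ha : exteriorPower.alternatingMapLinearEquiv a ∘ₗ wedgeProj k d V = g := by
    ext v
    simp only [LinearMap.compMultilinearMap_apply, LinearMap.comp_apply, wedgeProj_tprod,
      exteriorPower.alternatingMapLinearEquiv_apply_ιMulti]
    rfl
  rw [← ha]
  exact LinearMap.ker_le_ker_comp _ _

section Quotients

variable (k d)

/-- `Sym^d` as a quotient of the tensor power functor. -/
def symQuotient : TensorQuotient (sym k d) where
  proj V := (symRelations k d V.carrier).mkQ
  surjective _ := Submodule.mkQ_surjective _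
  natural _ _ := rfl

/-- `∧^d` as a quotient of the tensor power functor. -/
def wedgeQuotient : TensorQuotient (wedge k d) where
  proj V := wedgeProj k d V.carrier
  surjective _ := wedgeProj_surjective
  natural f x := (wedgeAction_wedgeProj f x).symm

variable {k d}

theorem symQuotient_isCoinvariants : (symQuotient k d).IsCoinvariants 1 := fun V => by
  have h : twistedRelations 1 V = symRelations k d V.carrier := by
    simp only [twistedRelations, symRelations, MonoidHom.one_apply, one_smul]
  rw [h]
  exact Submodule.ker_mkQ _

theorem wedgeQuotient_isTwisted : (wedgeQuotient k d).IsTwisted (signChar k) where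
  isEquivariant _ := wedgeProj_permAct
  ker_le_ker_twistedNorm V x hx := by
    rw [LinearMap.mem_ker, twistedNorm_signChar]
    exact (congrArg _ (LinearMap.mem_ker.mp hx)).trans (map_zero _)

theorem wedgeQuotient_isCoinvariants (h2 : IsUnit (2 : k)) :
    (wedgeQuotient k d).IsCoinvariants (signChar k) := fun V => by
  refine le_antisymm ?_ (twistedRelations_le_ker_iff.mpr wedgeProj_permAct)
  rw [← Submodule.ker_mkQ (twistedRelations (signChar k) V)]
  refine ker_wedgeProj_le_ker h2 (twistedRelations_le_ker_iff.mp ?_)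
  rw [Submodule.ker_mkQ]

end Quotients

end StrictPolynomial

end

theorem proposition3p11 (k : Type u) [CommRing k] (d : ℕ) :
    Nonempty (StrictPolynomial.internalTensor (StrictPolynomial.wedge k d)
        (StrictPolynomial.wedge k d) ≅ StrictPolynomial.sym k d) ∧
    Nonempty (StrictPolynomial.internalTensor (StrictPolynomial.sym k d)
        (StrictPolynomial.sym k d) ≅ StrictPolynomial.sym k d) ∧
    (IsUnit (2 : k) →
      Nonempty (StrictPolynomial.internalTensor (StrictPolynomial.sym k d)
        (StrictPolynomial.wedge k d) ≅ StrictPolynomial.wedge k d)) ∧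
    ((2 : k) = 0 →
      Nonempty (StrictPolynomial.internalTensor (StrictPolynomial.sym k d)
        (StrictPolynomial.wedge k d) ≅ StrictPolynomial.sym k d)) := by
  have hSym := StrictPolynomial.symQuotient_isCoinvariants (k := k) (d := d)
  have hWedge := StrictPolynomial.wedgeQuotient_isTwisted (k := k) (d := d)
  refine ⟨?_, ?_, fun h2 => ?_, fun h2 => ?_⟩
  · exact hWedge.nonempty_internalTensor_iso hWedge StrictPolynomial.signChar_mul_signChar hSym
  · exact hSym.isTwisted.nonempty_internalTensor_iso hSym.isTwisted (one_mul 1) hSym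
  · exact hSym.isTwisted.nonempty_internalTensor_iso hWedge (one_mul _)
      (StrictPolynomial.wedgeQuotient_isCoinvariants h2)
  · rw [StrictPolynomial.signChar_eq_one h2] at hWedge
    exact hSym.isTwisted.nonempty_internalTensor_iso hWedge (one_mul 1) hSym
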